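/- Let $p\ge 0$ be an integer, $\mathcal O\subset\mathbb R^p$ open, and $f,h:\mathcal O\to\mathbb R$ smooth functions of $(x_1,\dots,x_p)$. Let $M=\mathbb R\times\mathcal O\times\mathbb R^{p+1}$ with coordinates $(x_0,\dots,x_p,y_0,\dots,y_p)$, and write $f_i=\partial f/\partial x_i$, $h_i=\partial h/\partial x_i$. With $dx\odot dy:=dx\otimes dy+dy\otimes dx$, put $$g_{(f,h)}=\sum_{i=1}^p\bigl(f_i\,dx_0\odot dx_i+h_i\,dx_i\odot dy_0\bigr)+\sum_{i,j=1}^p (f_if_j+h_ih_j)\,dx_i\otimes dx_j+\sum_{i=1}^p dx_i\odot dy_i .$$ Let $\overline M$ be the $(2p+4)$-dimensional real vector space with basis $u_0,\dots,u_p,v_0,\dots,v_p,w_1,w_2$ and the symmetric bilinear form $\overline g$ whose only nonzero products of basis vectors are $\overline g(u_i,v_i)=1$ $(1\le i\le p)$, $\overline g(u_0,w_1)=\overline g(v_0,w_2)=1$, $\overline g(w_1,w_1)=\overline g(w_2,w_2)=1$ (and those given by symmetry). Let $F:M\to\overline M$, $F(x,y)=\sum_{i=0}^p x_iu_i+\sum_{i=0}^p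 y_iv_i+f\,w_1+h\,w_2$. Terminology. Let $M$ be a submanifold of $\overline M$ with induced metric $g$. It is $r$-lightlike if $\mathrm{Rad}\,TM=TM\cap TM^\perp$ is a smooth distribution of rank $r>0$, and coisotropic if moreover $r$ is the codimension of $M$. Screens consist of smooth complements $S(TM)$ of $\mathrm{Rad}\,TM$ in $TM$ and $S(TM^\perp)$ of $\mathrm{Rad}\,TM$ in $TM^\perp$ (so $S(TM^\perp)=0$ in the coisotropic case), together with a bundle $ltr(TM)\subset S(TM)^\perp\cap S(TM^\perp)^\perp$ locally spanned by smooth sections $N_1,\dots,N_r$ with $\overline g(N_i,\xi_j)=\delta_{ij}$, $\overline g(N_i,N_j)=0$ for a local frame $\xi_1,\dots,\xi_r$ of $\mathrm{Rad}\,TM$. Let $\nabla$ be the induced connection, i.e. the $TM$-part of the flat connection of $\overline M$ with respect to $T\overline M|_M=TM\oplus(ltr(TM)\oplus S(TM^\perp))$, and $R(X,Y,Z,W)=g(R(X,Y)Z,W)$ its curvature. The screens are admissible if $R$ is an algebraic curvature tensor at each point, i.e. $R(x,y,z,w)=-R(y,x,z,w)=R(z,w,x,y)$ and $R(x,y,z,w)+R(y,z,x,w)+R(z,x,y,w)=0$.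 Put $\eta_i=\overline g(N_i,\cdot)$ and $\tilde g=g+\sum_{i=1}^r\eta_i\otimes\eta_i$. For $x\in T_qM$ with $g(x,x)=\pm1$, the pseudo-Jacobi operator $J_R(x)$ on $T_qM$ is defined by $\tilde g(J_R(x)y,w)=R(y,x,x,w)$. $M$ is globally Osserman if, for all admissible screens, the characteristic polynomial of $J_R(x)$ does not depend on $q\in M$ and on $x\in T_qM$ with $g(x,x)=1$, and the same holds for the $x$ with $g(x,x)=-1$. Then: 1. $\overline g$ is nondegenerate of signature $(p+2,p+2)$; $F$ is a smooth embedding and $F^*\overline g=g_{(f,h)}$; the kernel of $g_{(f,h)}$ has dimension $2$ at every point; and $F(M)$ is a coisotropic ($2$-lightlike) submanifold of $\overline M$, with $\mathrm{Rad}\,TM$ spanned by $\xi_1=\partial_{x_0}-\sum_{i=1}^p f_i\,\partial_{y_i}$ and $\xi_2=\partial_{y_0}-\sum_{i=1}^p h_i\,\partial_{y_i}$. 2. $S(TM)=\mathrm{Span}\{\partial_{x_i}-f_i\partial_{x_0}-h_i\partial_{y_0},\ \partial_{y_i}: 1\le i\le p\}$, $S(TM^\perp)=0$ and $ltr(TM)=\mathrm{Span}\{w_1-\tfrac12\xi_1,\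 w_2-\tfrac12\xi_2\}$ are admissible screens. 3. For all admissible screens, all $q\in M$ and all $x\in T_qM$ with $g(x,x)=\pm1$, for any choice of dual bases $\xi_1,\xi_2$ and $N_1,N_2$ of $\mathrm{Rad}\,T_qM$ and of the fibre of $ltr(TM)$ at $q$, the operator $J_R(x)$ exists and is unique, is nilpotent, and has characteristic polynomial $\lambda^{2p+2}$. 4. Consequently $M$ is globally Osserman. -/

import Mathlib

open scoped ContDiff

noncomputable section

namespace LightlikeOsserman

section General

/-! ## Submanifolds of a semi-Euclidean space given by one global chart

`(V, B)` is the ambient vector space with its constant metric; the submanifold is the image of an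
open set `U` of `E` under `F : E → V`.  The tangent space at the point with coordinates `u` is
identified with `E` by the differential of `F` at `u`. -/

variable {E V : Type*} [NormedAddCommGroup E] [NormedSpace ℝ E]
  [NormedAddCommGroup V] [NormedSpace ℝ V]

/-- `B` is a semi-Euclidean metric of signature `(a, b)`. -/
structure IsSemiEuclidean (B : LinearMap.BilinForm ℝ V) (a b : ℕ) : Prop where
  symm : B.IsSymm
  nondegenerate : B.Nondegenerate
  sig_pos : sigPos B.toQuadraticMap = a
  sig_neg : sigNeg B.toQuadraticMap = b

/-- `F` is a smooth embedding of the open set `U`. -/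
structure IsSmoothEmbedding (U : Set E) (F : E → V) : Prop where
  isOpen : IsOpen U
  smooth : ContDiffOn ℝ ∞ F U
  immersion : ∀ u ∈ U, Function.Injective (fderiv ℝ F u)
  embedding : Topology.IsEmbedding (U.domRestrict F)

/-- The induced metric `F^* B`. -/
def inducedMetric (B : LinearMap.BilinForm ℝ V) (F : E → V) (u : E) : LinearMap.BilinForm ℝ E :=
  B.comp (fderiv ℝ F u).toLinearMap (fderiv ℝ F u).toLinearMap

/-- The tangent space as a subspace of the ambient space. -/
def tangentSpace (F : E → V) (u : E) : Submodule ℝ V :=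
  LinearMap.range (fderiv ℝ F u).toLinearMap

/-- The vectors which are `B`-orthogonal to `S`. -/
def perp (B : LinearMap.BilinForm ℝ V) (S : Submodule ℝ V) : Submodule ℝ V :=
  B.orthogonal S

/-- The radical of the tangent space, `T_u M ∩ T_u M^⊥`. -/
def radSpace (B : LinearMap.BilinForm ℝ V) (F : E → V) (u : E) : Submodule ℝ V :=
  tangentSpace F u ⊓ perp B (tangentSpace F u)

/-- `u ↦ S u` is a smooth vector subbundle over `U` of the trivial bundle with fibre `V`: it has
smooth local frames. -/
def IsSmoothSubbundle (U : Set E) (S : E → Submodule ℝ V) : Prop :=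
  ∀ u₀ ∈ U, ∃ W : Set E, IsOpen W ∧ u₀ ∈ W ∧ W ⊆ U ∧
    ∃ (k : ℕ) (s : Fin k → E → V), (∀ i, ContDiffOn ℝ ∞ (s i) W) ∧
      ∀ u ∈ W, LinearIndependent ℝ (fun i => s i u) ∧
        Submodule.span ℝ (Set.range fun i => s i u) = S u

/-- `r`-lightlike submanifold: the radical spaces form a smooth distribution of rank `r > 0`. -/
structure IsLightlike (B : LinearMap.BilinForm ℝ V) (F : E → V) (U : Set E) (r : ℕ) : Prop where
  isEmbedding : IsSmoothEmbedding U F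
  rank_pos : 0 < r
  smooth : IsSmoothSubbundle U (radSpace B F)
  rank : ∀ u ∈ U, Module.finrank ℝ (radSpace B F u) = r

/-- Coisotropic submanifold: the rank `r` of the radical distribution is the codimension. -/
structure IsCoisotropic (B : LinearMap.BilinForm ℝ V) (F : E → V) (U : Set E) (r : ℕ) : Prop where
  isLightlike : IsLightlike B F U r
  codim : Module.finrank ℝ V = Module.finrank ℝ E + r

/-- Underlying data of a choice of a screen distribution `S(TM)`, a screen transversal bundle
`S(TM^⊥)` and a lightlike transversal bundle `ltr(TM)`. -/
structure Screens (E V : Type*) [AddCommGroup V] [Module ℝ V] where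
  screen : E → Submodule ℝ V
  screenPerp : E → Submodule ℝ V
  ltr : E → Submodule ℝ V

/-- `tr(TM) = ltr(TM) ⊕ S(TM^⊥)`. -/
def Screens.tr (𝒮 : Screens E V) (u : E) : Submodule ℝ V :=
  𝒮.ltr u ⊔ 𝒮.screenPerp u

/-- `ξ` is a basis of the radical space at `u`, `N` is a basis of the fibre of `ltr(TM)` at `u`, and
`B (ξ i) (N j) = δ i j`, `B (N i) (N j) = 0`. -/
structure IsDualFrame (B : LinearMap.BilinForm ℝ V) (F : E → V) (𝒮 : Screens E V) (u : E)
    {r : ℕ} (ξ N : Fin r → V) : Prop where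
  ξ_indep : LinearIndependent ℝ ξ
  ξ_span : Submodule.span ℝ (Set.range ξ) = radSpace B F u
  N_span : Submodule.span ℝ (Set.range N) = 𝒮.ltr u
  pairing : ∀ i j, B (ξ i) (N j) = if i = j then 1 else 0
  N_null : ∀ i j, B (N i) (N j) = 0

/-- `S(TM)` is a complement of `Rad TM` in `TM` and `S(TM^⊥)` one of `Rad TM` in `TM^⊥` (such
complements are automatically nondegenerate); `ltr(TM)` is orthogonal to both and is locally
spanned by sections `N_i` dual to a local frame `ξ_i` of `Rad TM`. -/
structure IsScreens (B : LinearMap.BilinForm ℝ V) (F : E → V) (U : Set E) (r : ℕ)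
    (𝒮 : Screens E V) : Prop where
  screen_smooth : IsSmoothSubbundle U 𝒮.screen
  screen_disjoint : ∀ u ∈ U, Disjoint (radSpace B F u) (𝒮.screen u)
  screen_sup : ∀ u ∈ U, radSpace B F u ⊔ 𝒮.screen u = tangentSpace F u
  screenPerp_smooth : IsSmoothSubbundle U 𝒮.screenPerp
  screenPerp_disjoint : ∀ u ∈ U, Disjoint (radSpace B F u) (𝒮.screenPerp u)
  screenPerp_sup : ∀ u ∈ U, radSpace B F u ⊔ 𝒮.screenPerp u = perp B (tangentSpace F u)
  ltr_orthogonal : ∀ u ∈ U, 𝒮.ltr u ≤ perp B (𝒮.screen u) ⊓ perp B (𝒮.screenPerp u)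
  ltr_frame : ∀ u₀ ∈ U, ∃ W : Set E, IsOpen W ∧ u₀ ∈ W ∧ W ⊆ U ∧
    ∃ ξ N : Fin r → E → V, (∀ i, ContDiffOn ℝ ∞ (ξ i) W) ∧ (∀ i, ContDiffOn ℝ ∞ (N i) W) ∧
      ∀ u ∈ W, IsDualFrame B F 𝒮 u (fun i => ξ i u) (fun i => N i u)

open Classical in
/-- The tangential part of an ambient vector with respect to `V = T_u M ⊕ tr(T_u M)`, as an element
of the coordinate space `E`. -/
def tangentialPart (F : E → V) (𝒮 : Screens E V) (u : E) : V →ₗ[ℝ] E :=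
  if hb : Function.Bijective
      (LinearMap.coprod (fderiv ℝ F u).toLinearMap (𝒮.tr u).subtype) then
    LinearMap.fst ℝ E (𝒮.tr u) ∘ₗ (LinearEquiv.ofBijective _ hb).symm.toLinearMap
  else 0

/-- The induced connection `∇_X Y`: the tangential part of the flat derivative along `X` of the
vector field `Y`, considered as a field of ambient vectors. -/
def connection (F : E → V) (𝒮 : Screens E V) (X Y : E → E) (u : E) : E :=
  tangentialPart F 𝒮 u (fderiv ℝ (fun q => fderiv ℝ F q (Y q)) u (X u))

/-- `R(X, Y) Z = ∇_X ∇_Y Z - ∇_Y ∇_X Z - ∇_[X,Y] Z`. -/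
def curvature (F : E → V) (𝒮 : Screens E V) (X Y Z : E → E) (u : E) : E :=
  connection F 𝒮 X (connection F 𝒮 Y Z) u - connection F 𝒮 Y (connection F 𝒮 X Z) u
    - connection F 𝒮 (VectorField.lieBracket ℝ X Y) Z u

/-- The value at `u` of `R(x, y) z` for tangent vectors; by tensoriality, they may be extended to
vector fields with constant components in the chart. -/
def curvatureAt (F : E → V) (𝒮 : Screens E V) (u x y z : E) : E :=
  curvature F 𝒮 (fun _ => x) (fun _ => y) (fun _ => z) u

/-- The `(0,4)`-tensor `R(x, y, z, w) = g(R(x, y) z, w)` on `T_u M` of the induced connection. -/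
def IsInducedCurvature (B : LinearMap.BilinForm ℝ V) (F : E → V) (𝒮 : Screens E V) (u : E)
    (R : E →ₗ[ℝ] E →ₗ[ℝ] E →ₗ[ℝ] E →ₗ[ℝ] ℝ) : Prop :=
  ∀ x y z w, R x y z w = inducedMetric B F u (curvatureAt F 𝒮 u x y z) w

/-- Algebraic curvature maps. -/
structure IsAlgebraicCurvature (R : E →ₗ[ℝ] E →ₗ[ℝ] E →ₗ[ℝ] E →ₗ[ℝ] ℝ) : Prop where
  skew : ∀ x y z w, R x y z w = -R y x z w
  pair : ∀ x y z w, R x y z w = R z w x y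
  bianchi : ∀ x y z w, R x y z w + R y z x w + R z x y w = 0

/-- Admissible screens: the induced curvature is an algebraic curvature tensor at every point. -/
structure IsAdmissible (B : LinearMap.BilinForm ℝ V) (F : E → V) (U : Set E) (r : ℕ)
    (𝒮 : Screens E V) : Prop where
  isScreens : IsScreens B F U r 𝒮
  algebraic : ∀ u ∈ U, ∃ R, IsInducedCurvature B F 𝒮 u R ∧ IsAlgebraicCurvature R

/-- The associated metric `g̃ = g + ∑ η_i ⊗ η_i` at `u`, where `η_i(X) = B(N_i, X)`. -/
def associatedMetric (B : LinearMap.BilinForm ℝ V) (F : E → V) (u : E) {r : ℕ} (N : Fin r → V) :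
    LinearMap.BilinForm ℝ E :=
  inducedMetric B F u +
    ∑ i, LinearMap.BilinForm.linMulLin
      ((B (N i)) ∘ₗ (fderiv ℝ F u).toLinearMap) ((B (N i)) ∘ₗ (fderiv ℝ F u).toLinearMap)

/-- `J` is the pseudo-Jacobi operator `J_R(x)` for the nondegenerate metric `gt`:
`gt(J y, w) = R(y, x, x, w)`. -/
def IsPseudoJacobi (gt : LinearMap.BilinForm ℝ E) (R : E →ₗ[ℝ] E →ₗ[ℝ] E →ₗ[ℝ] E →ₗ[ℝ] ℝ)
    (x : E) (J : Module.End ℝ E) : Prop :=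
  ∀ y w, gt (J y) w = R y x x w

/-- At the point `u` the pseudo-Jacobi operator of the induced curvature with respect to `x` (for
any dual frames `ξ`, `N` used to form the associated metric) exists and has the characteristic
polynomial `P`. -/
def HasPseudoJacobiCharpoly (B : LinearMap.BilinForm ℝ V) (F : E → V) (r : ℕ) (𝒮 : Screens E V)
    [FiniteDimensional ℝ E] (u x : E) (P : Polynomial ℝ) : Prop :=
  ∀ R, IsInducedCurvature B F 𝒮 u R → ∀ ξ N : Fin r → V, IsDualFrame B F 𝒮 u ξ N →
    (∃ J, IsPseudoJacobi (associatedMetric B F u N) R x J) ∧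
    ∀ J, IsPseudoJacobi (associatedMetric B F u N) R x J → J.charpoly = P

/-- Globally Osserman: for all admissible screens, the characteristic polynomial of `J_R(x)` does
not depend on the unit spacelike vector `x`, nor on the unit timelike vector `x`, nor on the
point. -/
def IsGloballyOsserman (B : LinearMap.BilinForm ℝ V) (F : E → V) (U : Set E) (r : ℕ)
    [FiniteDimensional ℝ E] : Prop :=
  ∀ 𝒮 : Screens E V, IsAdmissible B F U r 𝒮 → ∀ ε : ℝ, ε = 1 ∨ ε = -1 →
    ∃ P : Polynomial ℝ, ∀ u ∈ U, ∀ x : E, inducedMetric B F u x x = ε →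
      HasPseudoJacobiCharpoly B F r 𝒮 u x P

end General

section Example

/-! ## The metric `g_(f,h)` on `ℝ × 𝒪 × ℝ^(p+1)` -/

/-- Coordinates `(x, y) = (x_0, …, x_p, y_0, …, y_p)`. -/
abbrev Coord (p : ℕ) : Type := (Fin (p + 1) → ℝ) × (Fin (p + 1) → ℝ)

/-- The ambient space, with coordinates with respect to the basis
`u_0, …, u_p, v_0, …, v_p, w_1, w_2`. -/
abbrev Ambient (p : ℕ) : Type := (Fin (p + 1) → ℝ) × (Fin (p + 1) → ℝ) × ℝ × ℝ

/-- `a ⊗ b + b ⊗ a`. -/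
def symProd {W : Type*} [AddCommGroup W] [Module ℝ W] (a b : W →ₗ[ℝ] ℝ) :
    LinearMap.BilinForm ℝ W :=
  LinearMap.BilinForm.linMulLin a b + LinearMap.BilinForm.linMulLin b a

/-- `dx_i` -/
def dx {p : ℕ} (i : Fin (p + 1)) : Coord p →ₗ[ℝ] ℝ :=
  LinearMap.proj i ∘ₗ LinearMap.fst ℝ (Fin (p + 1) → ℝ) (Fin (p + 1) → ℝ)

/-- `dy_i` -/
def dy {p : ℕ} (i : Fin (p + 1)) : Coord p →ₗ[ℝ] ℝ :=
  LinearMap.proj i ∘ₗ LinearMap.snd ℝ (Fin (p + 1) → ℝ) (Fin (p + 1) → ℝ)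

/-- The partial derivative `∂f/∂x_i` for a function of `(x_1, …, x_p)`. -/
def pd {p : ℕ} (f : (Fin p → ℝ) → ℝ) (i : Fin p) (a : Fin p → ℝ) : ℝ :=
  fderiv ℝ f a (Pi.single i 1)

/-- `M = ℝ × 𝒪 × ℝ^(p+1)`: the points with `(x_1, …, x_p) ∈ 𝒪`. -/
def domain {p : ℕ} (O : Set (Fin p → ℝ)) : Set (Coord p) :=
  {q | Fin.tail q.1 ∈ O}

/-- The metric `g_(f,h)`. -/
def metricFH {p : ℕ} (f h : (Fin p → ℝ) → ℝ) (q : Coord p) : LinearMap.BilinForm ℝ (Coord p) :=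
  ∑ i : Fin p, (pd f i (Fin.tail q.1) • symProd (dx 0) (dx i.succ)
      + pd h i (Fin.tail q.1) • symProd (dx i.succ) (dy 0))
  + ∑ i : Fin p, ∑ j : Fin p,
      (pd f i (Fin.tail q.1) * pd f j (Fin.tail q.1)
        + pd h i (Fin.tail q.1) * pd h j (Fin.tail q.1)) •
        LinearMap.BilinForm.linMulLin (dx i.succ) (dx j.succ)
  + ∑ i : Fin p, symProd (dx i.succ) (dy i.succ)

/-- Coordinate along `u_i`. -/
def cu {p : ℕ} (i : Fin (p + 1)) : Ambient p →ₗ[ℝ] ℝ :=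
  LinearMap.proj i ∘ₗ LinearMap.fst ℝ (Fin (p + 1) → ℝ) ((Fin (p + 1) → ℝ) × ℝ × ℝ)

/-- Coordinate along `v_i`. -/
def cv {p : ℕ} (i : Fin (p + 1)) : Ambient p →ₗ[ℝ] ℝ :=
  LinearMap.proj i ∘ₗ LinearMap.fst ℝ (Fin (p + 1) → ℝ) (ℝ × ℝ) ∘ₗ
    LinearMap.snd ℝ (Fin (p + 1) → ℝ) ((Fin (p + 1) → ℝ) × ℝ × ℝ)

/-- Coordinate along `w_1`. -/
def cw₁ {p : ℕ} : Ambient p →ₗ[ℝ] ℝ :=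
  LinearMap.fst ℝ ℝ ℝ ∘ₗ LinearMap.snd ℝ (Fin (p + 1) → ℝ) (ℝ × ℝ) ∘ₗ
    LinearMap.snd ℝ (Fin (p + 1) → ℝ) ((Fin (p + 1) → ℝ) × ℝ × ℝ)

/-- Coordinate along `w_2`. -/
def cw₂ {p : ℕ} : Ambient p →ₗ[ℝ] ℝ :=
  LinearMap.snd ℝ ℝ ℝ ∘ₗ LinearMap.snd ℝ (Fin (p + 1) → ℝ) (ℝ × ℝ) ∘ₗ
    LinearMap.snd ℝ (Fin (p + 1) → ℝ) ((Fin (p + 1) → ℝ) × ℝ × ℝ)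

/-- The ambient metric: the nonzero products of basis vectors are `u_i · v_i = 1` for
`1 ≤ i ≤ p`, `u_0 · w_1 = 1`, `v_0 · w_2 = 1`, `w_1 · w_1 = 1`, `w_2 · w_2 = 1`. -/
def ambientMetric (p : ℕ) : LinearMap.BilinForm ℝ (Ambient p) :=
  ∑ i : Fin p, symProd (cu i.succ) (cv i.succ) + symProd (cu 0) cw₁ + symProd (cv 0) cw₂
    + LinearMap.BilinForm.linMulLin cw₁ cw₁ + LinearMap.BilinForm.linMulLin cw₂ cw₂

/-- `F(x, y) = ∑ x_i u_i + ∑ y_i v_i + f w_1 + h w_2`. -/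
def embFH {p : ℕ} (f h : (Fin p → ℝ) → ℝ) (q : Coord p) : Ambient p :=
  (q.1, q.2, f (Fin.tail q.1), h (Fin.tail q.1))

/-- `ξ_1 = ∂/∂x_0 - ∑ (∂f/∂x_i) ∂/∂y_i`. -/
def xi₁ {p : ℕ} (f : (Fin p → ℝ) → ℝ) (q : Coord p) : Coord p :=
  (Pi.single 0 1, Fin.cons 0 fun i => -pd f i (Fin.tail q.1))

/-- `ξ_2 = ∂/∂y_0 - ∑ (∂h/∂x_i) ∂/∂y_i`. -/
def xi₂ {p : ℕ} (h : (Fin p → ℝ) → ℝ) (q : Coord p) : Coord p :=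
  (0, Fin.cons 1 fun i => -pd h i (Fin.tail q.1))

/-- `U_i = ∂/∂x_i - (∂f/∂x_i) ∂/∂x_0 - (∂h/∂x_i) ∂/∂y_0`. -/
def fieldU {p : ℕ} (f h : (Fin p → ℝ) → ℝ) (i : Fin p) (q : Coord p) : Coord p :=
  (Pi.single i.succ 1 - pd f i (Fin.tail q.1) • Pi.single 0 1,
    -(pd h i (Fin.tail q.1) • Pi.single 0 1))

/-- `V_i = ∂/∂y_i`. -/
def fieldV {p : ℕ} (i : Fin p) : Coord p :=
  (0, Pi.single i.succ 1)

/-- `N_1 = w_1 - ξ_1 / 2`. -/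
def trans₁ {p : ℕ} (f h : (Fin p → ℝ) → ℝ) (q : Coord p) : Ambient p :=
  (0, 0, 1, 0) - (1 / 2 : ℝ) • fderiv ℝ (embFH f h) q (xi₁ f q)

/-- `N_2 = w_2 - ξ_2 / 2`. -/
def trans₂ {p : ℕ} (f h : (Fin p → ℝ) → ℝ) (q : Coord p) : Ambient p :=
  (0, 0, 0, 1) - (1 / 2 : ℝ) • fderiv ℝ (embFH f h) q (xi₂ h q)

/-- `S(TM) = Span {U_i, V_i}`, `S(TM^⊥) = 0`, `ltr(TM) = Span {N_1, N_2}`. -/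
def screensFH {p : ℕ} (f h : (Fin p → ℝ) → ℝ) : Screens (Coord p) (Ambient p) where
  screen q := Submodule.span ℝ
    ((Set.range fun i : Fin p => fderiv ℝ (embFH f h) q (fieldU f h i q)) ∪
      Set.range fun i : Fin p => fderiv ℝ (embFH f h) q (fieldV i))
  screenPerp _ := ⊥
  ltr q := Submodule.span ℝ {trans₁ f h q, trans₂ f h q}

end Example

end LightlikeOsserman

end

namespace LightlikeOsserman

/-! ### Linear algebra -/

/-! The Osserman property rests on the subspace `K` of vectors with no `∂_{x_i}`-component for `1 ≤
i ≤ p`, i.e. `ker (tailL p)`. Since `f` and `h` depend only on `x_1, …, x_p`, `dF` sends such a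
vector to an ambient vector that does not depend on the point. Constant fields in `K` are therefore
parallel for every choice of screens, and `R(x, y)` kills `K` (`curvatureAt_embFH_eq_zero`).
Moreover `K` contains its own `g̃`-orthogonal complement (`tailL_eq_zero_of_associatedMetric`). When
`R` is an algebraic curvature tensor, these two facts give `im J ⊆ K ⊆ ker J`, so `J² = 0`
(`IsPseudoJacobi.isNilpotent`) and the characteristic polynomial is a power of `X`.

Admissibility of the explicit screens needs an actual curvature computation. The flat derivative of
a tangent field has normal parts `Hess f · w_1` and `Hess h · w_2`; as `w_i = N_i + ξ_i / 2`, the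
connection is the chart derivative plus half the Hessians times `ξ_1`, `ξ_2`
(`connection_screensFH`). Because `ξ_i` is `g`-null while `g(dξ_i(x), w)` is minus a Hessian, the
curvature is half the sum of the Gauss tensors of the two Hessians (`isInducedCurvature_screensFH`),
which is algebraic by symmetry of second derivatives. -/

theorem le_sigPos_of_injective {V W : Type*} [AddCommGroup V] [Module ℝ V] [Module.Finite ℝ V]
    [AddCommGroup W] [Module ℝ W] (Q : QuadraticForm ℝ V) (φ : W →ₗ[ℝ] V)
    (hφ : ∀ w, w ≠ 0 → 0 < Q (φ w)) : Module.finrank ℝ W ≤ sigPos Q := by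
  -- Positivity off zero already excludes a kernel, so the range of `φ` has the dimension of `W`.
  have hinj : Function.Injective φ := by
    rw [injective_iff_map_eq_zero]
    intro w hw
    by_contra h0
    have := hφ w h0
    simp [hw] at this
  rw [← LinearMap.finrank_range_of_inj hinj]
  apply le_sigPos_of_posDef
  rintro ⟨_, w, rfl⟩ hw
  rw [QuadraticMap.restrict_apply]
  refine hφ w ?_
  rintro rfl
  exact hw (by simp)

theorem existsUnique_isPseudoJacobi {E : Type*} [NormedAddCommGroup E] [NormedSpace ℝ E]
    [FiniteDimensional ℝ E] {B : LinearMap.BilinForm ℝ E} (hB : B.Nondegenerate)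
    (R : E →ₗ[ℝ] E →ₗ[ℝ] E →ₗ[ℝ] E →ₗ[ℝ] ℝ) (x : E) :
    ∃! J, IsPseudoJacobi B R x J := by
  -- The double flip is `y ↦ R y x x`, a map into the dual space, which `B` identifies with `E`.
  refine ⟨(B.toDual hB).symm.toLinearMap ∘ₗ ((R.flip x).flip x), ?_, ?_⟩
  · intro y w
    simp [LinearMap.BilinForm.apply_toDual_symm_apply]
  · intro J hJ
    ext1 y
    apply (B.toDual hB).injective
    ext w
    simp [LinearMap.BilinForm.toDual_def, hJ y w]

/-- If `R` vanishes on a subspace `K` containing its `B`-orthogonal complement, then the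
pseudo-Jacobi operators of `R` are nilpotent. -/
theorem IsPseudoJacobi.isNilpotent {E : Type*} [NormedAddCommGroup E] [NormedSpace ℝ E]
    {B : LinearMap.BilinForm ℝ E} (hB : B.Nondegenerate)
    {R : E →ₗ[ℝ] E →ₗ[ℝ] E →ₗ[ℝ] E →ₗ[ℝ] ℝ} (hR : IsAlgebraicCurvature R) {x : E}
    {J : Module.End ℝ E} (hJ : IsPseudoJacobi B R x J) (K : Submodule ℝ E)
    (hK : ∀ v, (∀ k ∈ K, B v k = 0) → v ∈ K) (hRK : ∀ x y w, ∀ k ∈ K, R x y k w = 0) :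
    IsNilpotent J := by
  -- Exponent 2 suffices: `J` maps everything into `K` and kills `K`.
  refine ⟨2, LinearMap.ext fun y => ?_⟩
  rw [pow_two, Module.End.mul_apply, LinearMap.zero_apply]
  have hmem : J y ∈ K := by
    refine hK _ fun k hk => ?_
    -- The symmetries move `k` from the fourth slot to the third: `R(y,x,x,k) = R(x,k,y,x) =
    -- -R(k,x,y,x) = -R(y,x,k,x)`.
    rw [hJ, hR.pair, hR.skew, hR.pair, hRK _ _ _ k hk, neg_zero]
  apply hB.1
  intro w
  rw [hJ, hR.pair, hRK _ _ _ _ hmem]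

/-- The `(0,4)`-tensor given by the Gauss equation for the second fundamental form `H`. -/
noncomputable def gaussTensor {E : Type*} [AddCommGroup E] [Module ℝ E]
    (H : LinearMap.BilinForm ℝ E) : E →ₗ[ℝ] E →ₗ[ℝ] E →ₗ[ℝ] E →ₗ[ℝ] ℝ :=
  LinearMap.mk₂ ℝ
    (fun x y => LinearMap.BilinForm.linMulLin (H x) (H y)
      - LinearMap.BilinForm.linMulLin (H y) (H x))
    (fun _ _ _ => by ext; simp; ring) (fun _ _ _ => by ext; simp; ring)
    (fun _ _ _ => by ext; simp; ring) (fun _ _ _ => by ext; simp; ring)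

theorem gaussTensor_apply {E : Type*} [AddCommGroup E] [Module ℝ E]
    (H : LinearMap.BilinForm ℝ E) (x y z w : E) :
    gaussTensor H x y z w = H x z * H y w - H y z * H x w := rfl

theorem isAlgebraicCurvature_gaussTensor {E : Type*} [NormedAddCommGroup E] [NormedSpace ℝ E]
    {H : LinearMap.BilinForm ℝ E} (hH : H.IsSymm) : IsAlgebraicCurvature (gaussTensor H) where
  skew x y z w := by simp only [gaussTensor_apply]; ring
  pair x y z w := by
    simp only [gaussTensor_apply]
    rw [hH.eq x z, hH.eq y w, hH.eq y z, hH.eq x w]; ring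
  bianchi x y z w := by
    simp only [gaussTensor_apply]
    rw [hH.eq y x, hH.eq z x, hH.eq z y]; ring

theorem IsAlgebraicCurvature.smul_add {E : Type*} [NormedAddCommGroup E] [NormedSpace ℝ E]
    {R S : E →ₗ[ℝ] E →ₗ[ℝ] E →ₗ[ℝ] E →ₗ[ℝ] ℝ} (hR : IsAlgebraicCurvature R)
    (hS : IsAlgebraicCurvature S) (c : ℝ) : IsAlgebraicCurvature (c • (R + S)) where
  skew x y z w := by
    simp only [LinearMap.smul_apply, LinearMap.add_apply, smul_eq_mul]
    rw [hR.skew, hS.skew]; ring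
  pair x y z w := by
    simp only [LinearMap.smul_apply, LinearMap.add_apply, smul_eq_mul]
    rw [hR.pair, hS.pair]
  bianchi x y z w := by
    simp only [LinearMap.smul_apply, LinearMap.add_apply, smul_eq_mul]
    linear_combination c * (hR.bianchi x y z w + hS.bianchi x y z w)

/-! ### Submanifolds given by one chart -/

section General

variable {E V : Type*} [NormedAddCommGroup E] [NormedSpace ℝ E]
  [NormedAddCommGroup V] [NormedSpace ℝ V]

theorem IsInducedCurvature.unique {B : LinearMap.BilinForm ℝ V} {F : E → V} {𝒮 : Screens E V}
    {u : E} {R S : E →ₗ[ℝ] E →ₗ[ℝ] E →ₗ[ℝ] E →ₗ[ℝ] ℝ} (hR : IsInducedCurvature B F 𝒮 u R)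
    (hS : IsInducedCurvature B F 𝒮 u S) : R = S := by
  ext x y z w
  rw [hR, hS]

/-- A global frame is a local one with `W = U`. The arbitrary finite index type allows frames such
as the `U_i`, `V_i`, indexed by a sum type. -/
theorem isSmoothSubbundle_of_frame {U : Set E} (hU : IsOpen U) {S : E → Submodule ℝ V}
    {ι : Type*} [Fintype ι] (s : ι → E → V) (hs : ∀ i, ContDiffOn ℝ ∞ (s i) U)
    (hli : ∀ u ∈ U, LinearIndependent ℝ fun i => s i u)
    (hspan : ∀ u ∈ U, Submodule.span ℝ (Set.range fun i => s i u) = S u) :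
    IsSmoothSubbundle U S := by
  intro u₀ hu₀
  refine ⟨U, hU, hu₀, subset_rfl, Fintype.card ι,
    fun i => s ((Fintype.equivFin ι).symm i), fun i => hs _, fun u hu => ⟨?_, ?_⟩⟩
  · exact (hli u hu).comp _ (Fintype.equivFin ι).symm.injective
  · rw [← hspan u hu]
    congr 1
    exact (Fintype.equivFin ι).symm.surjective.range_comp (fun i => s i u)

/-- Bijectivity excludes the default value `0` of `tangentialPart`; projections are then found by
exhibiting a decomposition. -/
theorem tangentialPart_eq {F : E → V} {𝒮 : Screens E V} {u : E}
    (hb : Function.Bijective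
      (LinearMap.coprod (fderiv ℝ F u).toLinearMap (𝒮.tr u).subtype))
    (v : E) {t : V} (ht : t ∈ 𝒮.tr u) :
    tangentialPart F 𝒮 u (fderiv ℝ F u v + t) = v := by
  rw [tangentialPart, dif_pos hb]
  have : fderiv ℝ F u v + t = LinearEquiv.ofBijective _ hb (v, ⟨t, ht⟩) := by simp
  rw [this, LinearMap.comp_apply, LinearEquiv.coe_coe, LinearEquiv.symm_apply_apply]
  rfl

/-- Only the germ of the differentiated field matters, so an inner connection may be replaced by a
formula valid near the point. -/
theorem connection_congr {F : E → V} {𝒮 : Screens E V} {X Y Y' : E → E} {u : E}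
    (h : Y =ᶠ[nhds u] Y') : connection F 𝒮 X Y u = connection F 𝒮 X Y' u := by
  have : (fun q => fderiv ℝ F q (Y q)) =ᶠ[nhds u] fun q => fderiv ℝ F q (Y' q) :=
    h.mono fun q hq => by simp only [hq]
  rw [connection, connection, this.fderiv_eq]

theorem connection_zero (F : E → V) (𝒮 : Screens E V) (X : E → E) (u : E) :
    connection F 𝒮 X (fun _ => 0) u = 0 := by
  simp [connection]

theorem connection_zero_left {F : E → V} {𝒮 : Screens E V} {X Y : E → E} {u : E}
    (hX : X u = 0) : connection F 𝒮 X Y u = 0 := by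
  simp [connection, hX]

/-- Fields with constant components commute, so the bracket term drops out. -/
theorem curvatureAt_eq (F : E → V) (𝒮 : Screens E V) (u x y z : E) :
    curvatureAt F 𝒮 u x y z =
      connection F 𝒮 (fun _ => x) (connection F 𝒮 (fun _ => y) fun _ => z) u
        - connection F 𝒮 (fun _ => y) (connection F 𝒮 (fun _ => x) fun _ => z) u := by
  rw [curvatureAt, curvature, sub_eq_self]
  apply connection_zero_left
  simp [VectorField.lieBracket]

/-- A constant field `z` whose ambient image is constant near `u` is parallel near `u`, so it is
annihilated by the curvature at `u`. -/
theorem curvatureAt_eq_zero {F : E → V} {𝒮 : Screens E V} {u z : E} {v : V}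
    (hz : ∀ᶠ q in nhds u, fderiv ℝ F q z = v) (x y : E) :
    curvatureAt F 𝒮 u x y z = 0 := by
  have key (y : E) : connection F 𝒮 (fun _ => y) (fun _ => z) =ᶠ[nhds u] fun _ => 0 := by
    -- The first derivative must vanish at all `q` near `u`, since it is differentiated again; this
    -- needs constancy near each such `q`.
    filter_upwards [hz.eventually_nhds] with q hq
    have : (fun q => fderiv ℝ F q z) =ᶠ[nhds q] fun _ => v := hq
    rw [connection, this.fderiv_eq]
    simp
  rw [curvatureAt_eq, connection_congr (key y), connection_congr (key x), connection_zero,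
    connection_zero, sub_zero]

theorem mem_perp_tangentSpace {B : LinearMap.BilinForm ℝ V} {F : E → V} {u : E} {v : V} :
    v ∈ perp B (tangentSpace F u) ↔ ∀ w, B (fderiv ℝ F u w) v = 0 := by
  simp [perp, tangentSpace, LinearMap.BilinForm.mem_orthogonal_iff]

theorem inducedMetric_apply (B : LinearMap.BilinForm ℝ V) (F : E → V) (u v w : E) :
    inducedMetric B F u v w = B (fderiv ℝ F u v) (fderiv ℝ F u w) := rfl

/-- Orthogonality to all tangent vectors is degeneracy for the pulled-back metric, so the radical
can be computed in the chart. -/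
theorem radSpace_eq_map (B : LinearMap.BilinForm ℝ V) (hB : B.IsSymm) (F : E → V) (u : E) :
    radSpace B F u =
      (LinearMap.ker (inducedMetric B F u)).map (fderiv ℝ F u).toLinearMap := by
  ext v
  simp only [radSpace, Submodule.mem_inf, mem_perp_tangentSpace, Submodule.mem_map,
    LinearMap.mem_ker]
  constructor
  · rintro ⟨⟨k, rfl⟩, hk⟩
    refine ⟨k, LinearMap.ext fun w => ?_, rfl⟩
    rw [inducedMetric_apply, hB.eq]
    exact hk w
  · rintro ⟨k, hk, rfl⟩
    refine ⟨⟨k, rfl⟩, fun w => ?_⟩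
    rw [hB.eq]
    exact LinearMap.congr_fun hk w

theorem associatedMetric_apply (B : LinearMap.BilinForm ℝ V) (F : E → V) (u : E) {r : ℕ}
    (N : Fin r → V) (v w : E) :
    associatedMetric B F u N v w = inducedMetric B F u v w
      + ∑ i, B (N i) (fderiv ℝ F u v) * B (N i) (fderiv ℝ F u w) := by
  simp [associatedMetric, LinearMap.sum_apply]

/-- A dual frame has lifts `k i` of the `ξ i` to the chart, with
`g̃(v, k i) = η_i(v)`. -/
theorem IsDualFrame.exists_lift {B : LinearMap.BilinForm ℝ V} (hB : B.IsSymm) {F : E → V}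
    {𝒮 : Screens E V} {u : E} {r : ℕ} {ξ N : Fin r → V} (hd : IsDualFrame B F 𝒮 u ξ N) :
    ∃ k : Fin r → E, (∀ i, fderiv ℝ F u (k i) = ξ i) ∧
      (∀ i, k i ∈ LinearMap.ker (inducedMetric B F u)) ∧
      ∀ i v, associatedMetric B F u N v (k i) = B (N i) (fderiv ℝ F u v) := by
  have hmem (i : Fin r) : ξ i ∈ radSpace B F u := by
    rw [← hd.ξ_span]
    exact Submodule.subset_span ⟨i, rfl⟩
  rw [radSpace_eq_map B hB] at hmem
  choose k hk hkξ using hmem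
  refine ⟨k, hkξ, hk, fun i v => ?_⟩
  have h0 : inducedMetric B F u v (k i) = 0 := by
    rw [inducedMetric_apply, hB.eq]
    exact LinearMap.congr_fun (hk i) v
  have h1 (j : Fin r) : B (N j) (fderiv ℝ F u (k i)) = if i = j then 1 else 0 := by
    rw [hB.eq, ← hd.pairing]
    exact congrArg (fun t => B t (N j)) (hkξ i)
  simp [associatedMetric_apply, h0, h1]

/-- If `v` is `g̃`-orthogonal to everything, pairing with the lifts of the `ξ_i` gives `η_i(v) = 0`.
Then `v` is `g`-null, hence a combination of the `ξ_i`, whose coefficients are the vanishing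
`η_i(v)`. -/
theorem IsDualFrame.nondegenerate_associatedMetric {B : LinearMap.BilinForm ℝ V} (hB : B.IsSymm)
    {F : E → V} {𝒮 : Screens E V} {u : E} (hinj : Function.Injective (fderiv ℝ F u)) {r : ℕ}
    {ξ N : Fin r → V} (hd : IsDualFrame B F 𝒮 u ξ N) :
    (associatedMetric B F u N).Nondegenerate := by
  obtain ⟨k, hkξ, hk, hη⟩ := hd.exists_lift hB
  have hleft : (associatedMetric B F u N).SeparatingLeft := by
    intro v hv
    have h0 (i : Fin r) : B (N i) (fderiv ℝ F u v) = 0 := by rw [← hη, hv]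
    have hrad : fderiv ℝ F u v ∈ radSpace B F u := by
      rw [radSpace_eq_map B hB]
      refine ⟨v, LinearMap.ext fun w => ?_, rfl⟩
      have := hv w
      rw [associatedMetric_apply] at this
      simpa [h0] using this
    rw [← hd.ξ_span, Submodule.mem_span_range_iff_exists_fun] at hrad
    obtain ⟨c, hc⟩ := hrad
    have hc0 (i : Fin r) : c i = 0 := by
      rw [← h0 i, ← hc]
      simp [hB.eq (N i), hd.pairing]
    apply hinj
    rw [← hc]
    simp [hc0]
  have hsymm (v w : E) :
      associatedMetric B F u N v w = associatedMetric B F u N w v := by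
    rw [associatedMetric_apply, associatedMetric_apply, inducedMetric_apply, hB.eq]
    simp only [mul_comm, inducedMetric_apply]
  exact ⟨hleft, fun v hv => hleft v fun w => by rw [hsymm, hv]⟩

end General

/-! ### The metric `g_(f,h)` -/

variable {p : ℕ} {O : Set (Fin p → ℝ)} {f h : (Fin p → ℝ) → ℝ}

/-! ### The ambient metric and its signature -/

theorem ambientMetric_apply (a b : Ambient p) :
    ambientMetric p a b =
      ∑ i : Fin p, (a.1 i.succ * b.2.1 i.succ + a.2.1 i.succ * b.1 i.succ)
        + (a.1 0 * b.2.2.1 + a.2.2.1 * b.1 0) + (a.2.1 0 * b.2.2.2 + a.2.2.2 * b.2.1 0)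
        + a.2.2.1 * b.2.2.1 + a.2.2.2 * b.2.2.2 := by
  simp [ambientMetric, symProd, LinearMap.sum_apply, cu, cv, cw₁, cw₂,
    LinearMap.BilinForm.linMulLin_apply]

theorem isSymm_ambientMetric : (ambientMetric p).IsSymm := by
  refine ⟨fun a b => ?_⟩
  simp only [ambientMetric_apply]
  have : ∑ i : Fin p, (a.1 i.succ * b.2.1 i.succ + a.2.1 i.succ * b.1 i.succ) =
      ∑ i : Fin p, (b.1 i.succ * a.2.1 i.succ + b.2.1 i.succ * a.1 i.succ) :=
    Finset.sum_congr rfl fun i _ => by ring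
  rw [this]
  ring

theorem nondegenerate_ambientMetric : (ambientMetric p).Nondegenerate := by
  have hleft : (ambientMetric p).SeparatingLeft := by
    intro a ha
    have hu (i : Fin p) : a.1 i.succ = 0 := by
      have := ha (0, Pi.single i.succ 1, 0, 0)
      simpa [ambientMetric_apply, Pi.single_apply] using this
    have hv (i : Fin p) : a.2.1 i.succ = 0 := by
      have := ha (Pi.single i.succ 1, 0, 0, 0)
      simpa [ambientMetric_apply, Pi.single_apply] using this
    have hw₁ : a.2.2.1 = 0 := by
      have := ha (Pi.single 0 1, 0, 0, 0)
      simpa [ambientMetric_apply] using this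
    have hw₂ : a.2.2.2 = 0 := by
      have := ha (0, Pi.single 0 1, 0, 0)
      simpa [ambientMetric_apply] using this
    -- `w_1` pairs with both `u_0` and itself, so its own coordinate must be known to vanish first;
    -- likewise for `w_2`.
    have hu₀ : a.1 0 = 0 := by
      have := ha (0, 0, 1, 0)
      simpa [ambientMetric_apply, hw₁] using this
    have hv₀ : a.2.1 0 = 0 := by
      have := ha (0, 0, 0, 1)
      simpa [ambientMetric_apply, hw₂] using this
    refine Prod.ext (funext fun i => ?_) (Prod.ext (funext fun i => ?_) (Prod.ext hw₁ hw₂))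
    · exact Fin.cases hu₀ hu i
    · exact Fin.cases hv₀ hv i
  exact ⟨hleft, fun a ha => hleft a fun b => by rw [isSymm_ambientMetric.eq, ha]⟩

/-- The coordinates `(a, s, t)` on definite subspaces of the ambient space. -/
abbrev DefiniteCoord (p : ℕ) : Type := (Fin p → ℝ) × ℝ × ℝ

/-- The inclusion of a maximal positive definite subspace. -/
def positiveIncl (p : ℕ) : DefiniteCoord p →ₗ[ℝ] Ambient p where
  -- Spanned by `u_i + v_i` of square 2 and by `w_1`, `w_2` of square 1.
  toFun a := (Fin.cons 0 a.1, Fin.cons 0 a.1, a.2.1, a.2.2)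
  map_add' a b := by
    refine Prod.ext (funext (Fin.cases ?_ fun i => ?_))
      (Prod.ext (funext (Fin.cases ?_ fun i => ?_)) rfl) <;> simp
  map_smul' c a := by
    refine Prod.ext (funext (Fin.cases ?_ fun i => ?_))
      (Prod.ext (funext (Fin.cases ?_ fun i => ?_)) rfl) <;> simp

/-- The inclusion of a maximal negative definite subspace. -/
def negativeIncl (p : ℕ) : DefiniteCoord p →ₗ[ℝ] Ambient p where
  -- Spanned by `u_i - v_i` of square -2 and by `u_0 - w_1`, `v_0 - w_2` of square `-2 + 1 = -1`.
  toFun a := (Fin.cons a.2.1 a.1, Fin.cons a.2.2 (-a.1), -a.2.1, -a.2.2)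
  map_add' a b := by
    refine Prod.ext (funext (Fin.cases ?_ fun i => ?_))
      (Prod.ext (funext (Fin.cases ?_ fun i => ?_)) ?_) <;> simp [add_comm]
  map_smul' c a := by
    refine Prod.ext (funext (Fin.cases ?_ fun i => ?_))
      (Prod.ext (funext (Fin.cases ?_ fun i => ?_)) ?_) <;> simp

/-- Up to sign, this is the ambient quadratic form on both definite subspaces. -/
theorem sum_sq_pos {a : DefiniteCoord p} (ha : a ≠ 0) :
    0 < ∑ i, 2 * (a.1 i * a.1 i) + a.2.1 * a.2.1 + a.2.2 * a.2.2 := by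
  have h0 : 0 ≤ ∑ i, 2 * (a.1 i * a.1 i) :=
    Finset.sum_nonneg fun i _ => mul_nonneg zero_le_two (mul_self_nonneg _)
  have h1 := mul_self_nonneg a.2.1
  have h2 := mul_self_nonneg a.2.2
  by_contra hle
  apply ha
  refine Prod.ext (funext fun i => ?_) (Prod.ext ?_ ?_)
  · have hsum : ∑ i, 2 * (a.1 i * a.1 i) = 0 := by linarith
    rw [Finset.sum_eq_zero_iff_of_nonneg
      fun i _ => mul_nonneg zero_le_two (mul_self_nonneg _)] at hsum
    simpa using hsum i (Finset.mem_univ i)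
  · exact mul_self_eq_zero.mp (by linarith)
  · exact mul_self_eq_zero.mp (by linarith)

theorem isSemiEuclidean_ambientMetric (p : ℕ) :
    IsSemiEuclidean (ambientMetric p) (p + 2) (p + 2) := by
  have hpos : p + 2 ≤ sigPos (ambientMetric p).toQuadraticMap := by
    have := le_sigPos_of_injective (ambientMetric p).toQuadraticMap (positiveIncl p)
      fun a ha => by
        convert sum_sq_pos ha using 1
        simp [ambientMetric_apply, positiveIncl, two_mul]
    simpa using this
  have hneg : p + 2 ≤ sigNeg (ambientMetric p).toQuadraticMap := by
    have := le_sigPos_of_injective (-(ambientMetric p).toQuadraticMap) (negativeIncl p)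
      fun a ha => by
        convert sum_sq_pos ha using 1
        simp only [ambientMetric_apply, negativeIncl, _root_.neg_apply,
          LinearMap.BilinMap.toQuadraticMap_apply, LinearMap.coe_mk, AddHom.coe_mk,
          Fin.cons_succ, Fin.cons_zero, Pi.neg_apply]
        rw [show ∑ i, (a.1 i * -a.1 i + -a.1 i * a.1 i) = -∑ i, 2 * (a.1 i * a.1 i) by
          rw [← Finset.sum_neg_distrib]; exact Finset.sum_congr rfl fun i _ => by ring]
        ring
    simpa using this
  -- The two indices are at least `p + 2` each and add up to at most the dimension `2p + 4`, so both
  -- bounds are equalities.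
  have hsum := QuadraticForm.sigPos_add_sigNeg_add_radical
    (Q := (ambientMetric p).toQuadraticMap)
  have hdim : Module.finrank ℝ (Ambient p) = 2 * p + 4 := by
    simp; ring
  exact ⟨isSymm_ambientMetric, nondegenerate_ambientMetric, by lia, by lia⟩

/-- The coordinates `(x_1, …, x_p)` of a vector, as a continuous linear map. -/
def tailL (p : ℕ) : Coord p →L[ℝ] (Fin p → ℝ) :=
  ContinuousLinearMap.pi fun i =>
    ContinuousLinearMap.proj i.succ ∘L
      ContinuousLinearMap.fst ℝ (Fin (p + 1) → ℝ) (Fin (p + 1) → ℝ)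

theorem tailL_apply (q : Coord p) : tailL p q = Fin.tail q.1 := rfl

theorem isOpen_domain (hO : IsOpen O) : IsOpen (domain O) :=
  hO.preimage (tailL p).continuous

theorem hasFDerivAt_comp_tail (hO : IsOpen O) (hf : ContDiffOn ℝ ∞ f O) {q : Coord p}
    (hq : q ∈ domain O) :
    HasFDerivAt (fun q : Coord p => f (Fin.tail q.1))
      (fderiv ℝ f (Fin.tail q.1) ∘L tailL p) q := by
  have h1 : HasFDerivAt f (fderiv ℝ f (Fin.tail q.1)) (tailL p q) :=
    ((hf.differentiableOn (by simp)).differentiableAt (hO.mem_nhds hq)).hasFDerivAt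
  exact h1.comp q (tailL p).hasFDerivAt

/-- `F` is a graph. The base point enters only through the last two coordinates, and these see only
the tail of `v`. -/
theorem fderiv_embFH (hO : IsOpen O) (hf : ContDiffOn ℝ ∞ f O) (hh : ContDiffOn ℝ ∞ h O)
    {q : Coord p} (hq : q ∈ domain O) (v : Coord p) :
    fderiv ℝ (embFH f h) q v = (v.1, v.2, fderiv ℝ f (Fin.tail q.1) (Fin.tail v.1),
      fderiv ℝ h (Fin.tail q.1) (Fin.tail v.1)) := by
  have := hasFDerivAt_fst.prodMk (hasFDerivAt_snd.prodMk
    ((hasFDerivAt_comp_tail hO hf hq).prodMk (hasFDerivAt_comp_tail hO hh hq)))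
  have h2 : HasFDerivAt (embFH f h) _ q := this
  rw [h2.fderiv]
  rfl

theorem fderiv_eq_sum_pd (f : (Fin p → ℝ) → ℝ) (a v : Fin p → ℝ) :
    fderiv ℝ f a v = ∑ i, pd f i a * v i := by
  conv_lhs => rw [pi_eq_sum_univ' v, map_sum]
  refine Finset.sum_congr rfl fun i _ => ?_
  rw [map_smul, smul_eq_mul, mul_comm, pd]

/-- Written with differentials in place of partial derivatives, the metric matches
`ambientMetric_apply` on the graph vectors term by term. -/
theorem metricFH_apply (f h : (Fin p → ℝ) → ℝ) (q v w : Coord p) :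
    metricFH f h q v w =
      ∑ i : Fin p, (v.1 i.succ * w.2 i.succ + v.2 i.succ * w.1 i.succ)
      + (v.1 0 * fderiv ℝ f (Fin.tail q.1) (Fin.tail w.1)
        + fderiv ℝ f (Fin.tail q.1) (Fin.tail v.1) * w.1 0)
      + (v.2 0 * fderiv ℝ h (Fin.tail q.1) (Fin.tail w.1)
        + fderiv ℝ h (Fin.tail q.1) (Fin.tail v.1) * w.2 0)
      + fderiv ℝ f (Fin.tail q.1) (Fin.tail v.1) * fderiv ℝ f (Fin.tail q.1) (Fin.tail w.1)
      + fderiv ℝ h (Fin.tail q.1) (Fin.tail v.1) * fderiv ℝ h (Fin.tail q.1) (Fin.tail w.1) := by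
  simp only [fderiv_eq_sum_pd, metricFH, symProd, LinearMap.add_apply, LinearMap.sum_apply,
    LinearMap.smul_apply, LinearMap.BilinForm.linMulLin_apply, smul_eq_mul, dx, dy,
    LinearMap.coe_comp, Function.comp_apply, LinearMap.fst_apply, LinearMap.snd_apply,
    LinearMap.proj_apply, Fin.tail]
  have e₁ (a b : Fin p → ℝ) : ∑ i, ∑ j, (a i * a j + b i * b j) * (v.1 i.succ * w.1 j.succ) =
      (∑ i, a i * v.1 i.succ) * (∑ i, a i * w.1 i.succ)
        + (∑ i, b i * v.1 i.succ) * ∑ i, b i * w.1 i.succ := by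
    simp only [Finset.sum_mul_sum, ← Finset.sum_add_distrib]
    exact Finset.sum_congr rfl fun i _ => Finset.sum_congr rfl fun j _ => by ring
  have e₂ (a b : Fin p → ℝ) :
      ∑ i, (a i * (v.1 0 * w.1 i.succ + v.1 i.succ * w.1 0)
          + b i * (v.1 i.succ * w.2 0 + v.2 0 * w.1 i.succ)) =
        (v.1 0 * ∑ i, a i * w.1 i.succ) + (∑ i, a i * v.1 i.succ) * w.1 0
          + ((v.2 0 * ∑ i, b i * w.1 i.succ) + (∑ i, b i * v.1 i.succ) * w.2 0) := by
    simp only [Finset.mul_sum, Finset.sum_mul, ← Finset.sum_add_distrib]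
    exact Finset.sum_congr rfl fun i _ => by ring
  rw [e₁ (fun i => pd f i _) (fun i => pd h i _), e₂ (fun i => pd f i _) (fun i => pd h i _)]
  ring

theorem inducedMetric_embFH (hO : IsOpen O) (hf : ContDiffOn ℝ ∞ f O) (hh : ContDiffOn ℝ ∞ h O)
    {q : Coord p} (hq : q ∈ domain O) :
    inducedMetric (ambientMetric p) (embFH f h) q = metricFH f h q := by
  refine LinearMap.ext fun v => LinearMap.ext fun w => ?_
  rw [inducedMetric_apply, fderiv_embFH hO hf hh hq, fderiv_embFH hO hf hh hq,
    ambientMetric_apply, metricFH_apply]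

theorem contDiffOn_comp_tail {G : Type*} [NormedAddCommGroup G] [NormedSpace ℝ G]
    {φ : (Fin p → ℝ) → G} (hφ : ContDiffOn ℝ ∞ φ O) :
    ContDiffOn ℝ ∞ (fun q : Coord p => φ (Fin.tail q.1)) (domain O) :=
  hφ.comp (tailL p).contDiff.contDiffOn fun _ hq => hq

theorem isSmoothEmbedding_embFH (hO : IsOpen O) (hf : ContDiffOn ℝ ∞ f O)
    (hh : ContDiffOn ℝ ∞ h O) : IsSmoothEmbedding (domain O) (embFH f h) where
  isOpen := isOpen_domain hO
  smooth := contDiff_fst.contDiffOn.prodMk (contDiff_snd.contDiffOn.prodMk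
    ((contDiffOn_comp_tail hf).prodMk (contDiffOn_comp_tail hh)))
  immersion q hq v w hvw := by
    simp only [fderiv_embFH hO hf hh hq, Prod.mk.injEq] at hvw
    exact Prod.ext hvw.1 hvw.2.1
  embedding := by
    have hsmooth : ContDiffOn ℝ ∞ (embFH f h) (domain O) :=
      contDiff_fst.contDiffOn.prodMk (contDiff_snd.contDiffOn.prodMk
        ((contDiffOn_comp_tail hf).prodMk (contDiffOn_comp_tail hh)))
    -- Dropping the `w`-coordinates is a continuous left inverse of `F`.
    have hval : Topology.IsEmbedding
        ((fun a : Ambient p => ((a.1, a.2.1) : Coord p)) ∘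
          (domain O).domRestrict (embFH f h)) :=
      Topology.IsEmbedding.subtypeVal
    exact Topology.IsEmbedding.of_comp
      (continuousOn_iff_continuous_domRestrict.mp hsmooth.continuousOn) (by fun_prop) hval

/-! ### The radical and coisotropy -/

theorem tail_single_zero (c : ℝ) : Fin.tail (Pi.single 0 c : Fin (p + 1) → ℝ) = 0 := by
  ext i
  simp [Fin.tail]

/-- Testing against `∂_{y_i}` kills the `x_i`-components, and testing against `∂_{x_i}` then
determines the `y_i`-components; only `x_0` and `y_0` remain free. -/
theorem mem_ker_metricFH {q v : Coord p} :
    v ∈ LinearMap.ker (metricFH f h q) ↔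
      v = v.1 0 • xi₁ f q + v.2 0 • xi₂ h q := by
  constructor
  · intro hv
    have hx : Fin.tail v.1 = 0 := by
      ext i
      have := LinearMap.congr_fun hv ((0, Pi.single i.succ 1) : Coord p)
      have h0 : Fin.tail (0 : Fin (p + 1) → ℝ) = 0 := rfl
      simpa [metricFH_apply, h0, Pi.single_apply, Fin.tail] using this
    have hx' (i : Fin p) : v.1 i.succ = 0 := congrFun hx i
    have hy (i : Fin p) : v.2 i.succ =
        - (v.1 0 * pd f i (Fin.tail q.1) + v.2 0 * pd h i (Fin.tail q.1)) := by
      have := LinearMap.congr_fun hv ((Pi.single i.succ 1, 0) : Coord p)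
      have h1 : Fin.tail (Pi.single i.succ 1 : Fin (p + 1) → ℝ) = Pi.single i 1 := by
        ext j; simp [Fin.tail, Pi.single_apply]
      simp [metricFH_apply, h1, hx, Pi.single_apply] at this
      simp only [pd]
      linarith
    refine Prod.ext (funext (Fin.cases ?_ fun i => ?_)) (funext (Fin.cases ?_ fun i => ?_))
    · simp [xi₁, xi₂]
    · simp [xi₁, xi₂, hx']
    · simp [xi₁, xi₂]
    · simp [xi₁, xi₂, hy]; ring
  · intro hv
    rw [hv]
    refine LinearMap.ext fun w => ?_
    simp only [map_add, map_smul, LinearMap.add_apply, LinearMap.smul_apply]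
    have h0 : Fin.tail (0 : Fin (p + 1) → ℝ) = 0 := rfl
    simp [metricFH_apply, xi₁, xi₂, tail_single_zero, h0, fderiv_eq_sum_pd, Fin.tail]

theorem xi_mem_ker (q : Coord p) : xi₁ f q ∈ LinearMap.ker (metricFH f h q) ∧
    xi₂ h q ∈ LinearMap.ker (metricFH f h q) := by
  constructor <;> rw [mem_ker_metricFH] <;> simp [xi₁, xi₂]

theorem ker_metricFH (q : Coord p) :
    LinearMap.ker (metricFH f h q) = Submodule.span ℝ {xi₁ f q, xi₂ h q} := by
  apply le_antisymm
  · intro v hv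
    rw [mem_ker_metricFH] at hv
    exact Submodule.mem_span_pair.mpr ⟨_, _, hv.symm⟩
  · rw [Submodule.span_le]
    rintro _ (rfl | rfl)
    exacts [(xi_mem_ker q).1, (xi_mem_ker q).2]

theorem linearIndependent_xi (f h : (Fin p → ℝ) → ℝ) (q : Coord p) :
    LinearIndependent ℝ ![xi₁ f q, xi₂ h q] := by
  rw [LinearIndependent.pair_iff]
  intro s t hst
  have h1 := congrFun (congrArg Prod.fst hst) 0
  have h2 := congrFun (congrArg Prod.snd hst) 0
  constructor
  · simpa [xi₁, xi₂] using h1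
  · simpa [xi₁, xi₂] using h2

theorem finrank_ker_metricFH (q : Coord p) :
    Module.finrank ℝ (LinearMap.ker (metricFH f h q)) = 2 := by
  have := finrank_span_eq_card (linearIndependent_xi f h q)
  rw [ker_metricFH, ← Matrix.range_cons_cons_empty _ _ ![]]
  simpa using this

theorem radSpace_embFH (hO : IsOpen O) (hf : ContDiffOn ℝ ∞ f O) (hh : ContDiffOn ℝ ∞ h O)
    {q : Coord p} (hq : q ∈ domain O) :
    radSpace (ambientMetric p) (embFH f h) q =
      Submodule.span ℝ {fderiv ℝ (embFH f h) q (xi₁ f q), fderiv ℝ (embFH f h) q (xi₂ h q)} := by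
  rw [radSpace_eq_map _ isSymm_ambientMetric, inducedMetric_embFH hO hf hh hq, ker_metricFH,
    Submodule.map_span, Set.image_pair]
  rfl

theorem contDiffOn_pd (hO : IsOpen O) (hf : ContDiffOn ℝ ∞ f O) (i : Fin p) :
    ContDiffOn ℝ ∞ (pd f i) O :=
  (hf.fderiv_of_isOpen hO (by simp)).clm_apply contDiffOn_const

theorem contDiffOn_xi₁ (hO : IsOpen O) (hf : ContDiffOn ℝ ∞ f O) :
    ContDiffOn ℝ ∞ (xi₁ f) (domain O) := by
  refine contDiffOn_const.prodMk (contDiffOn_pi.mpr (Fin.cases ?_ fun i => ?_))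
  · exact contDiffOn_const
  · exact (contDiffOn_comp_tail (contDiffOn_pd hO hf i)).neg

theorem contDiffOn_xi₂ (hO : IsOpen O) (hh : ContDiffOn ℝ ∞ h O) :
    ContDiffOn ℝ ∞ (xi₂ h) (domain O) := by
  refine contDiffOn_const.prodMk (contDiffOn_pi.mpr (Fin.cases ?_ fun i => ?_))
  · exact contDiffOn_const
  · exact (contDiffOn_comp_tail (contDiffOn_pd hO hh i)).neg

theorem contDiffOn_fderiv_embFH (hO : IsOpen O) (hf : ContDiffOn ℝ ∞ f O)
    (hh : ContDiffOn ℝ ∞ h O) {X : Coord p → Coord p} (hX : ContDiffOn ℝ ∞ X (domain O)) :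
    ContDiffOn ℝ ∞ (fun q => fderiv ℝ (embFH f h) q (X q)) (domain O) :=
  ((isSmoothEmbedding_embFH hO hf hh).smooth.fderiv_of_isOpen (isOpen_domain hO)
    (by simp)).clm_apply hX

/-- The frame `ξ_1, ξ_2` of the radical distribution as ambient vector fields. -/
noncomputable def radFrame (f h : (Fin p → ℝ) → ℝ) (i : Fin 2) (q : Coord p) : Ambient p :=
  fderiv ℝ (embFH f h) q (![xi₁ f q, xi₂ h q] i)

theorem contDiffOn_radFrame (hO : IsOpen O) (hf : ContDiffOn ℝ ∞ f O)
    (hh : ContDiffOn ℝ ∞ h O) (i : Fin 2) : ContDiffOn ℝ ∞ (radFrame f h i) (domain O) := by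
  apply contDiffOn_fderiv_embFH hO hf hh
  fin_cases i
  exacts [contDiffOn_xi₁ hO hf, contDiffOn_xi₂ hO hh]

theorem linearIndependent_radFrame (hO : IsOpen O) (hf : ContDiffOn ℝ ∞ f O)
    (hh : ContDiffOn ℝ ∞ h O) {q : Coord p} (hq : q ∈ domain O) :
    LinearIndependent ℝ fun i => radFrame f h i q :=
  (linearIndependent_xi f h q).map' (fderiv ℝ (embFH f h) q).toLinearMap
    (LinearMap.ker_eq_bot.mpr ((isSmoothEmbedding_embFH hO hf hh).immersion q hq))

theorem span_radFrame (hO : IsOpen O) (hf : ContDiffOn ℝ ∞ f O)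
    (hh : ContDiffOn ℝ ∞ h O) {q : Coord p} (hq : q ∈ domain O) :
    Submodule.span ℝ (Set.range fun i => radFrame f h i q) =
      radSpace (ambientMetric p) (embFH f h) q := by
  rw [radSpace_embFH hO hf hh hq, ← Matrix.range_cons_cons_empty _ _ ![]]
  congr 2
  ext i : 1
  fin_cases i <;> rfl

theorem isCoisotropic_embFH (hO : IsOpen O) (hf : ContDiffOn ℝ ∞ f O)
    (hh : ContDiffOn ℝ ∞ h O) :
    IsCoisotropic (ambientMetric p) (embFH f h) (domain O) 2 where
  isLightlike :=
    { isEmbedding := isSmoothEmbedding_embFH hO hf hh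
      rank_pos := two_pos
      smooth := isSmoothSubbundle_of_frame (isOpen_domain hO) (radFrame f h)
        (contDiffOn_radFrame hO hf hh) (fun _ hq => linearIndependent_radFrame hO hf hh hq)
        (fun _ hq => span_radFrame hO hf hh hq)
      rank := fun q hq => by
        rw [← span_radFrame hO hf hh hq,
          finrank_span_eq_card (linearIndependent_radFrame hO hf hh hq), Fintype.card_fin] }
  codim := by simp; ring

/-! ### The screens spanned by `U_i`, `V_i` and `N_1`, `N_2` -/

/-- The linear map with values `U_i`, `V_i` on the standard basis. -/
noncomputable def screenLift (f h : (Fin p → ℝ) → ℝ) (q : Coord p) :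
    (Fin p → ℝ) × (Fin p → ℝ) →ₗ[ℝ] Coord p where
  toFun a := (Fin.cons (-fderiv ℝ f (Fin.tail q.1) a.1) a.1,
    Fin.cons (-fderiv ℝ h (Fin.tail q.1) a.1) a.2)
  map_add' a b := by
    refine Prod.ext (funext (Fin.cases ?_ fun i => ?_))
      (funext (Fin.cases ?_ fun i => ?_)) <;> simp [add_comm]
  map_smul' c a := by
    refine Prod.ext (funext (Fin.cases ?_ fun i => ?_))
      (funext (Fin.cases ?_ fun i => ?_)) <;> simp

theorem screenLift_apply (q : Coord p) (a : (Fin p → ℝ) × (Fin p → ℝ)) :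
    screenLift f h q a = (Fin.cons (-fderiv ℝ f (Fin.tail q.1) a.1) a.1,
      Fin.cons (-fderiv ℝ h (Fin.tail q.1) a.1) a.2) := rfl

theorem screenLift_injective (q : Coord p) : Function.Injective (screenLift f h q) := by
  intro a b hab
  simp only [screenLift_apply, Prod.mk.injEq, Fin.cons_inj] at hab
  exact Prod.ext hab.1.2 hab.2.2

/-- The frame `U_1, …, U_p, V_1, …, V_p` in the chart. -/
noncomputable def screenChartFrame (f h : (Fin p → ℝ) → ℝ) (i : Fin p ⊕ Fin p) (q : Coord p) :
    Coord p :=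
  Sum.elim (fun i => fieldU f h i q) fieldV i

theorem screenLift_basis (q : Coord p) (i : Fin p ⊕ Fin p) :
    screenLift f h q (((Pi.basisFun ℝ (Fin p)).prod (Pi.basisFun ℝ (Fin p))) i) =
      screenChartFrame f h i q := by
  rcases i with i | i
  · refine Prod.ext (funext (Fin.cases ?_ fun j => ?_))
      (funext (Fin.cases ?_ fun j => ?_)) <;>
      simp [screenLift_apply, screenChartFrame, fieldU, pd, Pi.single_apply]
  · refine Prod.ext (funext (Fin.cases ?_ fun j => ?_))
      (funext (Fin.cases ?_ fun j => ?_)) <;>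
      simp [screenLift_apply, screenChartFrame, fieldV, Pi.single_apply]

theorem linearIndependent_screenChartFrame (q : Coord p) :
    LinearIndependent ℝ fun i => screenChartFrame f h i q := by
  simp only [← screenLift_basis]
  exact (Module.Basis.linearIndependent _).map' _
    (LinearMap.ker_eq_bot.mpr (screenLift_injective q))

theorem span_screenChartFrame (q : Coord p) :
    Submodule.span ℝ (Set.range fun i => screenChartFrame f h i q) =
      LinearMap.range (screenLift f h q) := by
  simp only [← screenLift_basis]
  rw [LinearMap.range_eq_map, ← Module.Basis.span_eq, Submodule.map_span, ← Set.range_comp]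
  rfl

/-- The screen is cut out by the forms `dx_0 + df` and `dy_0 + dh`. These are also the products with
`w_1`, `w_2`, and with `N_1`, `N_2`, on tangent vectors. -/
theorem mem_range_screenLift {q v : Coord p} :
    v ∈ LinearMap.range (screenLift f h q) ↔
      v.1 0 + fderiv ℝ f (Fin.tail q.1) (Fin.tail v.1) = 0 ∧
        v.2 0 + fderiv ℝ h (Fin.tail q.1) (Fin.tail v.1) = 0 := by
  constructor
  · rintro ⟨a, rfl⟩
    simp [screenLift_apply]
  · rintro ⟨h1, h2⟩
    refine ⟨(Fin.tail v.1, Fin.tail v.2), ?_⟩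
    rw [screenLift_apply, ← eq_neg_of_add_eq_zero_left h1, ← eq_neg_of_add_eq_zero_left h2,
      Fin.cons_self_tail, Fin.cons_self_tail]

theorem screensFH_screen (f h : (Fin p → ℝ) → ℝ) (q : Coord p) :
    (screensFH f h).screen q =
      (LinearMap.range (screenLift f h q)).map (fderiv ℝ (embFH f h) q).toLinearMap := by
  rw [← span_screenChartFrame, Submodule.map_span, ← Set.range_comp]
  change Submodule.span ℝ (_ ∪ _) = _
  rw [← Set.Sum.elim_range]
  congr 2
  ext i : 1
  rcases i with i | i <;> rfl

theorem contDiffOn_screenChartFrame (hO : IsOpen O) (hf : ContDiffOn ℝ ∞ f O)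
    (hh : ContDiffOn ℝ ∞ h O) (i : Fin p ⊕ Fin p) :
    ContDiffOn ℝ ∞ (screenChartFrame f h i) (domain O) := by
  rcases i with i | i
  · exact (contDiffOn_const.sub ((contDiffOn_comp_tail (contDiffOn_pd hO hf i)).smul
      contDiffOn_const)).prodMk ((contDiffOn_comp_tail (contDiffOn_pd hO hh i)).smul
      contDiffOn_const).neg
  · exact contDiffOn_const

theorem isSmoothSubbundle_screenFH (hO : IsOpen O) (hf : ContDiffOn ℝ ∞ f O)
    (hh : ContDiffOn ℝ ∞ h O) : IsSmoothSubbundle (domain O) (screensFH f h).screen := by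
  refine isSmoothSubbundle_of_frame (isOpen_domain hO)
    (fun i q => fderiv ℝ (embFH f h) q (screenChartFrame f h i q)) (fun i => ?_)
    (fun q hq => ?_) (fun q _ => ?_)
  · exact contDiffOn_fderiv_embFH hO hf hh (contDiffOn_screenChartFrame hO hf hh i)
  · exact (linearIndependent_screenChartFrame q).map' (fderiv ℝ (embFH f h) q).toLinearMap
      (LinearMap.ker_eq_bot.mpr ((isSmoothEmbedding_embFH hO hf hh).immersion q hq))
  · rw [screensFH_screen, ← span_screenChartFrame, Submodule.map_span, ← Set.range_comp]
    rfl

theorem tail_xi₁ (q : Coord p) : Fin.tail (xi₁ f q).1 = 0 := tail_single_zero 1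

theorem tail_xi₂ (q : Coord p) : Fin.tail (xi₂ h q).1 = 0 := rfl

theorem disjoint_radSpace_screenFH (hO : IsOpen O) (hf : ContDiffOn ℝ ∞ f O)
    (hh : ContDiffOn ℝ ∞ h O) {q : Coord p} (hq : q ∈ domain O) :
    Disjoint (radSpace (ambientMetric p) (embFH f h) q) ((screensFH f h).screen q) := by
  rw [radSpace_eq_map _ isSymm_ambientMetric, inducedMetric_embFH hO hf hh hq, screensFH_screen]
  apply Submodule.disjoint_map ((isSmoothEmbedding_embFH hO hf hh).immersion q hq)
  rw [Submodule.disjoint_def]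
  intro v hv hv'
  rw [mem_ker_metricFH] at hv
  rw [mem_range_screenLift] at hv'
  have ht : Fin.tail v.1 = 0 := by
    have : Fin.tail v.1 = v.1 0 • Fin.tail (xi₁ f q).1 + v.2 0 • Fin.tail (xi₂ h q).1 :=
      congrArg (tailL p) hv
    rw [this, tail_xi₁, tail_xi₂]
    simp
  simp only [ht, map_zero, add_zero] at hv'
  rw [hv, hv'.1, hv'.2]
  simp

theorem radSpace_sup_screenFH (hO : IsOpen O) (hf : ContDiffOn ℝ ∞ f O)
    (hh : ContDiffOn ℝ ∞ h O) {q : Coord p} (hq : q ∈ domain O) :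
    radSpace (ambientMetric p) (embFH f h) q ⊔ (screensFH f h).screen q =
      tangentSpace (embFH f h) q := by
  rw [radSpace_eq_map _ isSymm_ambientMetric, inducedMetric_embFH hO hf hh hq, screensFH_screen,
    ← Submodule.map_sup, tangentSpace, LinearMap.range_eq_map (fderiv ℝ (embFH f h) q).toLinearMap]
  congr 1
  rw [eq_top_iff]
  intro v _
  -- `ξ_1`, `ξ_2` are dual to the two forms defining the screen, so subtracting the values of the
  -- forms times the `ξ_i` projects onto the screen.
  set s := v.1 0 + fderiv ℝ f (Fin.tail q.1) (Fin.tail v.1) with hs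
  set t := v.2 0 + fderiv ℝ h (Fin.tail q.1) (Fin.tail v.1) with ht
  have hrad : s • xi₁ f q + t • xi₂ h q ∈ LinearMap.ker (metricFH f h q) :=
    add_mem (Submodule.smul_mem _ _ (xi_mem_ker q).1) (Submodule.smul_mem _ _ (xi_mem_ker q).2)
  have hscr : v - (s • xi₁ f q + t • xi₂ h q) ∈ LinearMap.range (screenLift f h q) := by
    have htail : Fin.tail (v - (s • xi₁ f q + t • xi₂ h q)).1 = Fin.tail v.1 := by
      change tailL p (v - (s • xi₁ f q + t • xi₂ h q)) = _
      simp only [map_sub, map_add, map_smul, tailL_apply, tail_xi₁, tail_xi₂]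
      simp
    rw [mem_range_screenLift, htail]
    constructor <;> simp [hs, ht, xi₁, xi₂]
  rw [← add_sub_cancel (s • xi₁ f q + t • xi₂ h q) v]
  exact Submodule.add_mem_sup hrad hscr

theorem ambientMetric_w₁ (hO : IsOpen O) (hf : ContDiffOn ℝ ∞ f O)
    (hh : ContDiffOn ℝ ∞ h O) {q : Coord p} (hq : q ∈ domain O) (v : Coord p) :
    ambientMetric p (fderiv ℝ (embFH f h) q v) (0, 0, 1, 0) =
      v.1 0 + fderiv ℝ f (Fin.tail q.1) (Fin.tail v.1) := by
  simp [fderiv_embFH hO hf hh hq, ambientMetric_apply]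

theorem ambientMetric_w₂ (hO : IsOpen O) (hf : ContDiffOn ℝ ∞ f O)
    (hh : ContDiffOn ℝ ∞ h O) {q : Coord p} (hq : q ∈ domain O) (v : Coord p) :
    ambientMetric p (fderiv ℝ (embFH f h) q v) (0, 0, 0, 1) =
      v.2 0 + fderiv ℝ h (Fin.tail q.1) (Fin.tail v.1) := by
  simp [fderiv_embFH hO hf hh hq, ambientMetric_apply]

theorem ambientMetric_xi₁ (hO : IsOpen O) (hf : ContDiffOn ℝ ∞ f O)
    (hh : ContDiffOn ℝ ∞ h O) {q : Coord p} (hq : q ∈ domain O) (v : Coord p) :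
    ambientMetric p (fderiv ℝ (embFH f h) q v) (fderiv ℝ (embFH f h) q (xi₁ f q)) = 0 := by
  rw [isSymm_ambientMetric.eq, ← inducedMetric_apply, inducedMetric_embFH hO hf hh hq]
  exact LinearMap.congr_fun (xi_mem_ker q).1 v

theorem ambientMetric_xi₂ (hO : IsOpen O) (hf : ContDiffOn ℝ ∞ f O)
    (hh : ContDiffOn ℝ ∞ h O) {q : Coord p} (hq : q ∈ domain O) (v : Coord p) :
    ambientMetric p (fderiv ℝ (embFH f h) q v) (fderiv ℝ (embFH f h) q (xi₂ h q)) = 0 := by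
  rw [isSymm_ambientMetric.eq, ← inducedMetric_apply, inducedMetric_embFH hO hf hh hq]
  exact LinearMap.congr_fun (xi_mem_ker q).2 v

theorem ambientMetric_trans₁ (hO : IsOpen O) (hf : ContDiffOn ℝ ∞ f O)
    (hh : ContDiffOn ℝ ∞ h O) {q : Coord p} (hq : q ∈ domain O) (v : Coord p) :
    ambientMetric p (fderiv ℝ (embFH f h) q v) (trans₁ f h q) =
      v.1 0 + fderiv ℝ f (Fin.tail q.1) (Fin.tail v.1) := by
  rw [trans₁, map_sub, map_smul, ambientMetric_w₁ hO hf hh hq, ambientMetric_xi₁ hO hf hh hq,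
    smul_zero, sub_zero]

theorem ambientMetric_trans₂ (hO : IsOpen O) (hf : ContDiffOn ℝ ∞ f O)
    (hh : ContDiffOn ℝ ∞ h O) {q : Coord p} (hq : q ∈ domain O) (v : Coord p) :
    ambientMetric p (fderiv ℝ (embFH f h) q v) (trans₂ f h q) =
      v.2 0 + fderiv ℝ h (Fin.tail q.1) (Fin.tail v.1) := by
  rw [trans₂, map_sub, map_smul, ambientMetric_w₂ hO hf hh hq, ambientMetric_xi₂ hO hf hh hq,
    smul_zero, sub_zero]

/-- The frame `N_1, N_2` of the lightlike transversal bundle. -/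
noncomputable def transFrame (f h : (Fin p → ℝ) → ℝ) (i : Fin 2) (q : Coord p) : Ambient p :=
  ![trans₁ f h q, trans₂ f h q] i

theorem contDiffOn_transFrame (hO : IsOpen O) (hf : ContDiffOn ℝ ∞ f O)
    (hh : ContDiffOn ℝ ∞ h O) (i : Fin 2) : ContDiffOn ℝ ∞ (transFrame f h i) (domain O) := by
  fin_cases i
  · exact contDiffOn_const.sub ((contDiffOn_radFrame hO hf hh 0).const_smul (1 / 2 : ℝ))
  · exact contDiffOn_const.sub ((contDiffOn_radFrame hO hf hh 1).const_smul (1 / 2 : ℝ))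

theorem span_transFrame (f h : (Fin p → ℝ) → ℝ) (q : Coord p) :
    Submodule.span ℝ (Set.range fun i => transFrame f h i q) = (screensFH f h).ltr q := by
  change _ = Submodule.span ℝ {trans₁ f h q, trans₂ f h q}
  rw [← Matrix.range_cons_cons_empty _ _ ![]]
  rfl

/-- The coefficient `1/2` makes `N_i` null: `w_i · w_i = w_i · ξ_i = 1` and `ξ_i · ξ_i = 0` give `1
- 2 · (1/2) = 0`. -/
theorem isDualFrame_screensFH (hO : IsOpen O) (hf : ContDiffOn ℝ ∞ f O)
    (hh : ContDiffOn ℝ ∞ h O) {q : Coord p} (hq : q ∈ domain O) :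
    IsDualFrame (ambientMetric p) (embFH f h) (screensFH f h) q
      (fun i => radFrame f h i q) (fun i => transFrame f h i q) := by
  refine ⟨linearIndependent_radFrame hO hf hh hq, span_radFrame hO hf hh hq,
    span_transFrame f h q, fun i j => ?_, fun i j => ?_⟩
  · fin_cases i <;> fin_cases j <;>
      simp [radFrame, transFrame, ambientMetric_trans₁ hO hf hh hq,
        ambientMetric_trans₂ hO hf hh hq, tail_xi₁, tail_xi₂] <;> simp [xi₁, xi₂]
  · fin_cases i <;> fin_cases j <;>
      simp [transFrame, trans₁, trans₂, ambientMetric_xi₁ hO hf hh hq,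
        ambientMetric_xi₂ hO hf hh hq, ambientMetric_w₁ hO hf hh hq,
        ambientMetric_w₂ hO hf hh hq, tail_xi₁, tail_xi₂,
        isSymm_ambientMetric.eq (_, _, _, _) (fderiv ℝ (embFH f h) q _)] <;>
      simp [xi₁, xi₂, ambientMetric_apply] <;> norm_num

theorem isScreens_screensFH (hO : IsOpen O) (hf : ContDiffOn ℝ ∞ f O)
    (hh : ContDiffOn ℝ ∞ h O) :
    IsScreens (ambientMetric p) (embFH f h) (domain O) 2 (screensFH f h) where
  screen_smooth := isSmoothSubbundle_screenFH hO hf hh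
  screen_disjoint _ hq := disjoint_radSpace_screenFH hO hf hh hq
  screen_sup _ hq := radSpace_sup_screenFH hO hf hh hq
  screenPerp_smooth := isSmoothSubbundle_of_frame (isOpen_domain hO) (ι := Fin 0)
    (fun i => i.elim0) (fun i => i.elim0) (fun _ _ => linearIndependent_empty_type)
    (fun q _ => by simp [screensFH])
  screenPerp_disjoint _ _ := disjoint_bot_right
  screenPerp_sup q hq := by
    have hrad : radSpace (ambientMetric p) (embFH f h) q ⊔ (screensFH f h).screenPerp q =
      radSpace (ambientMetric p) (embFH f h) q := sup_bot_eq _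
    rw [hrad]
    -- Coisotropy: the radical lies in `TM^⊥`, and both have dimension 2.
    apply Submodule.eq_of_le_of_finrank_eq inf_le_right
    refine ((isCoisotropic_embFH hO hf hh).isLightlike.rank q hq).trans ?_
    have hdim := LinearMap.BilinForm.finrank_orthogonal nondegenerate_ambientMetric
      (tangentSpace (embFH f h) q)
    have htan : Module.finrank ℝ (tangentSpace (embFH f h) q) = Module.finrank ℝ (Coord p) :=
      LinearMap.finrank_range_of_inj ((isSmoothEmbedding_embFH hO hf hh).immersion q hq)
    rw [htan, (isCoisotropic_embFH hO hf hh).codim, Nat.add_sub_cancel_left] at hdim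
    exact hdim.symm
  ltr_orthogonal q hq := by
    refine le_inf ?_ ?_
    · intro t ht
      change t ∈ (ambientMetric p).orthogonal _
      rw [LinearMap.BilinForm.mem_orthogonal_iff, screensFH_screen]
      rintro _ ⟨v, hv, rfl⟩
      rw [SetLike.mem_coe, mem_range_screenLift] at hv
      change t ∈ Submodule.span ℝ {trans₁ f h q, trans₂ f h q} at ht
      obtain ⟨a, b, rfl⟩ := Submodule.mem_span_pair.mp ht
      change ambientMetric p (fderiv ℝ (embFH f h) q v) _ = 0
      rw [map_add, map_smul, map_smul, ambientMetric_trans₁ hO hf hh hq,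
        ambientMetric_trans₂ hO hf hh hq, hv.1, hv.2]
      simp
    · intro t _
      change t ∈ (ambientMetric p).orthogonal ⊥
      simp
  ltr_frame q hq := ⟨domain O, isOpen_domain hO, hq, subset_rfl, radFrame f h, transFrame f h,
    contDiffOn_radFrame hO hf hh, contDiffOn_transFrame hO hf hh,
    fun _ hq => isDualFrame_screensFH hO hf hh hq⟩

/-! ### Curvature -/

theorem tr_screensFH (f h : (Fin p → ℝ) → ℝ) (q : Coord p) :
    (screensFH f h).tr q = Submodule.span ℝ {trans₁ f h q, trans₂ f h q} :=
  sup_bot_eq _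

theorem bijective_coprod_screensFH (hO : IsOpen O) (hf : ContDiffOn ℝ ∞ f O)
    (hh : ContDiffOn ℝ ∞ h O) {q : Coord p} (hq : q ∈ domain O) :
    Function.Bijective (LinearMap.coprod (fderiv ℝ (embFH f h) q).toLinearMap
      ((screensFH f h).tr q).subtype) := by
  constructor
  · rw [injective_iff_map_eq_zero]
    rintro ⟨v, t, ht⟩ hvt
    have hvt : fderiv ℝ (embFH f h) q v + t = 0 := hvt
    have ht' := ht
    rw [tr_screensFH] at ht'
    obtain ⟨a, b, rfl⟩ := Submodule.mem_span_pair.mp ht'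
    -- Pairing with `ξ_1` and `ξ_2` kills the tangential summand and isolates the coefficients of
    -- `N_1` and `N_2`.
    have h1 := congrArg (ambientMetric p (fderiv ℝ (embFH f h) q (xi₁ f q))) hvt
    have h2 := congrArg (ambientMetric p (fderiv ℝ (embFH f h) q (xi₂ h q))) hvt
    rw [map_add, map_add, map_smul, map_smul, ambientMetric_trans₁ hO hf hh hq,
      ambientMetric_trans₂ hO hf hh hq, isSymm_ambientMetric.eq, ambientMetric_xi₁ hO hf hh hq,
      tail_xi₁] at h1
    rw [map_add, map_add, map_smul, map_smul, ambientMetric_trans₁ hO hf hh hq,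
      ambientMetric_trans₂ hO hf hh hq, isSymm_ambientMetric.eq, ambientMetric_xi₂ hO hf hh hq,
      tail_xi₂] at h2
    have ha : a = 0 := by simpa [xi₁] using h1
    have hb : b = 0 := by simpa [xi₂] using h2
    subst ha hb
    have hv : v = 0 := by
      apply (isSmoothEmbedding_embFH hO hf hh).immersion q hq
      simpa using hvt
    simp [hv]
  · intro w
    -- `c` and `d` measure how far `w` is from the tangent vector with the same `u`- and
    -- `v`-coordinates. Substituting `w_i = N_i + ξ_i / 2` produces the halves below.
    set c := w.2.2.1 - fderiv ℝ f (Fin.tail q.1) (Fin.tail w.1)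
    set d := w.2.2.2 - fderiv ℝ h (Fin.tail q.1) (Fin.tail w.1)
    have hmem : c • trans₁ f h q + d • trans₂ f h q ∈ (screensFH f h).tr q := by
      rw [tr_screensFH]
      exact Submodule.mem_span_pair.mpr ⟨c, d, rfl⟩
    refine ⟨((w.1, w.2.1) + (c / 2) • xi₁ f q + (d / 2) • xi₂ h q, ⟨_, hmem⟩), ?_⟩
    have hw : w = fderiv ℝ (embFH f h) q (w.1, w.2.1)
        + (c • (0, 0, 1, 0) + d • (0, 0, 0, 1)) := by
      rw [fderiv_embFH hO hf hh hq]
      refine Prod.ext ?_ (Prod.ext ?_ (Prod.ext ?_ ?_)) <;> simp [c, d]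
    conv_rhs => rw [hw]
    simp only [LinearMap.coprod_apply, ContinuousLinearMap.coe_coe, map_add, map_smul,
      Submodule.coe_subtype, trans₁, trans₂]
    module

/-- The Hessian of a function of `(x_1, …, x_p)`, as a bilinear form on the chart. -/
noncomputable def hessian (f : (Fin p → ℝ) → ℝ) (q : Coord p) : LinearMap.BilinForm ℝ (Coord p) :=
  LinearMap.mk₂ ℝ
    (fun v w => fderiv ℝ (fderiv ℝ f) (Fin.tail q.1) (tailL p v) (tailL p w))
    (by simp) (by simp) (by simp) (by simp)

theorem hessian_apply (f : (Fin p → ℝ) → ℝ) (q v w : Coord p) :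
    hessian f q v w = fderiv ℝ (fderiv ℝ f) (Fin.tail q.1) (tailL p v) (tailL p w) := rfl

theorem isSymm_hessian (hO : IsOpen O) (hf : ContDiffOn ℝ ∞ f O) {q : Coord p}
    (hq : q ∈ domain O) : (hessian f q).IsSymm :=
  ⟨fun _ _ => ((hf.contDiffAt (hO.mem_nhds hq)).isSymmSndFDerivAt
    (by simpa using WithTop.coe_le_coe.mpr (le_top (a := (2 : ℕ∞))))).eq _ _⟩

theorem contDiffOn_hessian (hO : IsOpen O) (hf : ContDiffOn ℝ ∞ f O) (v w : Coord p) :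
    ContDiffOn ℝ ∞ (fun q => hessian f q v w) (domain O) :=
  contDiffOn_comp_tail (φ := fun a => fderiv ℝ (fderiv ℝ f) a (tailL p v) (tailL p w))
    ((((hf.fderiv_of_isOpen (m := ∞) hO (by simp)).fderiv_of_isOpen (m := ∞) hO
      (by simp)).clm_apply
      contDiffOn_const).clm_apply contDiffOn_const)

theorem hasFDerivAt_fderiv_comp_tail (hO : IsOpen O) (hf : ContDiffOn ℝ ∞ f O) {q : Coord p}
    (hq : q ∈ domain O) :
    HasFDerivAt (fun q : Coord p => fderiv ℝ f (Fin.tail q.1))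
      (fderiv ℝ (fderiv ℝ f) (Fin.tail q.1) ∘L tailL p) q := by
  have hf' : ContDiffOn ℝ ∞ (fderiv ℝ f) O := hf.fderiv_of_isOpen hO (by simp)
  have h1 : HasFDerivAt (fderiv ℝ f) (fderiv ℝ (fderiv ℝ f) (Fin.tail q.1)) (tailL p q) :=
    ((hf'.differentiableOn (by simp)).differentiableAt (hO.mem_nhds hq)).hasFDerivAt
  exact h1.comp q (tailL p).hasFDerivAt

/-- The flat derivative of a tangent vector field `Y`. -/
theorem fderiv_fderiv_embFH (hO : IsOpen O) (hf : ContDiffOn ℝ ∞ f O)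
    (hh : ContDiffOn ℝ ∞ h O) {q : Coord p} (hq : q ∈ domain O) {Y : Coord p → Coord p}
    (hY : DifferentiableAt ℝ Y q) (x : Coord p) :
    fderiv ℝ (fun q => fderiv ℝ (embFH f h) q (Y q)) q x =
      fderiv ℝ (embFH f h) q (fderiv ℝ Y q x)
        + (hessian f q x (Y q) • (0, 0, 1, 0) + hessian h q x (Y q) • (0, 0, 0, 1)) := by
  have hev : (fun q => fderiv ℝ (embFH f h) q (Y q)) =ᶠ[nhds q] fun q => ((Y q).1, (Y q).2,
      fderiv ℝ f (Fin.tail q.1) (tailL p (Y q)), fderiv ℝ h (Fin.tail q.1) (tailL p (Y q))) := by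
    filter_upwards [(isOpen_domain hO).mem_nhds hq] with q hq
    exact fderiv_embFH hO hf hh hq (Y q)
  have hT := (tailL p).hasFDerivAt.comp q hY.hasFDerivAt
  have := (hasFDerivAt_fst.comp q hY.hasFDerivAt).prodMk
    ((hasFDerivAt_snd.comp q hY.hasFDerivAt).prodMk
      (((hasFDerivAt_fderiv_comp_tail hO hf hq).clm_apply hT).prodMk
        ((hasFDerivAt_fderiv_comp_tail hO hh hq).clm_apply hT)))
  rw [hev.fderiv_eq]
  refine (congrArg (fun L => L x) this.fderiv).trans ?_
  rw [fderiv_embFH hO hf hh hq]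
  refine Prod.ext ?_ (Prod.ext ?_ (Prod.ext ?_ ?_)) <;> simp [hessian_apply, tailL_apply]

/-- The flat derivative has Hessian components along `w_1`, `w_2`, and the tangential part of `w_i =
N_i + ξ_i / 2` is `ξ_i / 2`. -/
theorem connection_screensFH (hO : IsOpen O) (hf : ContDiffOn ℝ ∞ f O)
    (hh : ContDiffOn ℝ ∞ h O) {q : Coord p} (hq : q ∈ domain O) {X Y : Coord p → Coord p}
    (hY : DifferentiableAt ℝ Y q) :
    connection (embFH f h) (screensFH f h) X Y q = fderiv ℝ Y q (X q)
      + (hessian f q (X q) (Y q) • (1 / 2 : ℝ) • xi₁ f q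
        + hessian h q (X q) (Y q) • (1 / 2 : ℝ) • xi₂ h q) := by
  have hmem : hessian f q (X q) (Y q) • trans₁ f h q + hessian h q (X q) (Y q) • trans₂ f h q ∈
      (screensFH f h).tr q := by
    rw [tr_screensFH]
    exact Submodule.mem_span_pair.mpr ⟨_, _, rfl⟩
  rw [← tangentialPart_eq (bijective_coprod_screensFH hO hf hh hq)
    (fderiv ℝ Y q (X q) + (hessian f q (X q) (Y q) • (1 / 2 : ℝ) • xi₁ f q
        + hessian h q (X q) (Y q) • (1 / 2 : ℝ) • xi₂ h q)) hmem,
    connection, fderiv_fderiv_embFH hO hf hh hq hY]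
  congr 1
  simp only [map_add, map_smul, trans₁, trans₂]
  module

/-- The derivative has only `∂_{y_i}`-components with `i ≥ 1`, which the metric pairs with `dx_i`
alone. The constants `a`, `c` cover `ξ_1` and `ξ_2` at once. -/
theorem metricFH_fderiv_of_pd (hO : IsOpen O) {φ : (Fin p → ℝ) → ℝ} (hφ : ContDiffOn ℝ ∞ φ O)
    {q : Coord p} (hq : q ∈ domain O) (a : Fin (p + 1) → ℝ) (c : ℝ) (x w : Coord p) :
    metricFH f h q (fderiv ℝ (fun q : Coord p =>
      ((a, Fin.cons c fun i => -pd φ i (Fin.tail q.1)) : Coord p)) q x) w = -hessian φ q x w := by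
  have hpd (i : Fin p) : HasFDerivAt (fun q : Coord p => -pd φ i (Fin.tail q.1))
      (-((ContinuousLinearMap.apply ℝ ℝ (Pi.single i 1)) ∘L
        (fderiv ℝ (fderiv ℝ φ) (Fin.tail q.1) ∘L tailL p))) q :=
    (((ContinuousLinearMap.apply ℝ ℝ (Pi.single i 1)).hasFDerivAt).comp q
      (hasFDerivAt_fderiv_comp_tail hO hφ hq)).neg
  have hy : HasFDerivAt (fun q : Coord p =>
      (Fin.cons c fun i => -pd φ i (Fin.tail q.1) : Fin (p + 1) → ℝ))
      (ContinuousLinearMap.pi (Fin.cons 0 fun i =>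
        -((ContinuousLinearMap.apply ℝ ℝ (Pi.single i 1)) ∘L
        (fderiv ℝ (fderiv ℝ φ) (Fin.tail q.1) ∘L tailL p)))) q :=
    hasFDerivAt_pi.mpr (Fin.cases (hasFDerivAt_const _ _) hpd)
  rw [((hasFDerivAt_const a q).prodMk hy).fderiv, metricFH_apply, hessian_apply]
  have h0 : Fin.tail (0 : Fin (p + 1) → ℝ) = 0 := rfl
  have hsum : fderiv ℝ (fderiv ℝ φ) (Fin.tail q.1) (tailL p x) (tailL p w) =
      ∑ i, fderiv ℝ (fderiv ℝ φ) (Fin.tail q.1) (tailL p x) (Pi.single i 1) * w.1 i.succ := by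
    conv_lhs => rw [pi_eq_sum_univ' (tailL p w), map_sum]
    exact Finset.sum_congr rfl fun i _ => by
      rw [map_smul, smul_eq_mul, mul_comm]; rfl
  simp [h0, hsum]

theorem metricFH_fderiv_xi₁ (hO : IsOpen O) (hf : ContDiffOn ℝ ∞ f O) {q : Coord p}
    (hq : q ∈ domain O) (x w : Coord p) :
    metricFH f h q (fderiv ℝ (xi₁ f) q x) w = -hessian f q x w :=
  metricFH_fderiv_of_pd hO hf hq _ _ x w

theorem metricFH_fderiv_xi₂ (hO : IsOpen O) (hh : ContDiffOn ℝ ∞ h O) {q : Coord p}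
    (hq : q ∈ domain O) (x w : Coord p) :
    metricFH f h q (fderiv ℝ (xi₂ h) q x) w = -hessian h q x w :=
  metricFH_fderiv_of_pd hO hh hq _ _ x w

/-- Derivatives of the Hessian coefficients, like the new connection terms, are multiples of `ξ_1`,
`ξ_2`, which `g` annihilates; only the derivatives of the `ξ_i` contribute. -/
theorem metricFH_connection_connection (hO : IsOpen O) (hf : ContDiffOn ℝ ∞ f O)
    (hh : ContDiffOn ℝ ∞ h O) {q : Coord p} (hq : q ∈ domain O) (x y z w : Coord p) :
    metricFH f h q (connection (embFH f h) (screensFH f h) (fun _ => x)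
      (connection (embFH f h) (screensFH f h) (fun _ => y) fun _ => z) q) w =
      -(1 / 2) * (hessian f q y z * hessian f q x w + hessian h q y z * hessian h q x w) := by
  have hξ₁ : metricFH f h q (xi₁ f q) = 0 := (xi_mem_ker q).1
  have hξ₂ : metricFH f h q (xi₂ h q) = 0 := (xi_mem_ker q).2
  have hnhds := (isOpen_domain hO).mem_nhds hq
  have hev : connection (embFH f h) (screensFH f h) (fun _ => y) (fun _ => z) =ᶠ[nhds q]
      fun q => (1 / 2 * hessian f q y z) • xi₁ f q + (1 / 2 * hessian h q y z) • xi₂ h q := by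
    filter_upwards [hnhds] with q hq
    rw [connection_screensFH hO hf hh hq (differentiableAt_const z)]
    simp only [fderiv_fun_const, Pi.zero_apply, _root_.zero_apply]
    module
  have diff {G : Type} [NormedAddCommGroup G] [NormedSpace ℝ G] {φ : Coord p → G}
      (hφ : ContDiffOn ℝ ∞ φ (domain O)) : HasFDerivAt φ (fderiv ℝ φ q) q :=
    ((hφ.differentiableOn (by simp)).differentiableAt hnhds).hasFDerivAt
  have hd₁ := ((diff (contDiffOn_hessian hO hf y z)).const_mul (1 / 2)).smul
    (diff (contDiffOn_xi₁ hO hf))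
  have hd₂ := ((diff (contDiffOn_hessian hO hh y z)).const_mul (1 / 2)).smul
    (diff (contDiffOn_xi₂ hO hh))
  have hd : HasFDerivAt (fun q => (1 / 2 * hessian f q y z) • xi₁ f q
      + (1 / 2 * hessian h q y z) • xi₂ h q) _ q := hd₁.add hd₂
  rw [connection_congr hev, connection_screensFH hO hf hh hq hd.differentiableAt, hd.fderiv]
  simp only [map_add, map_smul, LinearMap.add_apply, LinearMap.smul_apply,
    _root_.add_apply, _root_.smul_apply,
    ContinuousLinearMap.smulRight_apply, hξ₁, hξ₂, LinearMap.zero_apply,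
    metricFH_fderiv_xi₁ hO hf hq, metricFH_fderiv_xi₂ hO hh hq, smul_eq_mul]
  ring

theorem isInducedCurvature_screensFH (hO : IsOpen O) (hf : ContDiffOn ℝ ∞ f O)
    (hh : ContDiffOn ℝ ∞ h O) {q : Coord p} (hq : q ∈ domain O) :
    IsInducedCurvature (ambientMetric p) (embFH f h) (screensFH f h) q
      ((1 / 2 : ℝ) • (gaussTensor (hessian f q) + gaussTensor (hessian h q))) := by
  intro x y z w
  rw [inducedMetric_embFH hO hf hh hq, curvatureAt_eq, map_sub, LinearMap.sub_apply,
    metricFH_connection_connection hO hf hh hq, metricFH_connection_connection hO hf hh hq]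
  simp only [LinearMap.smul_apply, LinearMap.add_apply, gaussTensor_apply, smul_eq_mul]
  ring

theorem isAdmissible_screensFH (hO : IsOpen O) (hf : ContDiffOn ℝ ∞ f O)
    (hh : ContDiffOn ℝ ∞ h O) :
    IsAdmissible (ambientMetric p) (embFH f h) (domain O) 2 (screensFH f h) where
  isScreens := isScreens_screensFH hO hf hh
  algebraic _ hq := ⟨_, isInducedCurvature_screensFH hO hf hh hq,
    (isAlgebraicCurvature_gaussTensor (isSymm_hessian hO hf hq)).smul_add
      (isAlgebraicCurvature_gaussTensor (isSymm_hessian hO hh hq)) _⟩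

/-! ### The Osserman property -/

theorem curvatureAt_embFH_eq_zero (hO : IsOpen O) (hf : ContDiffOn ℝ ∞ f O)
    (hh : ContDiffOn ℝ ∞ h O) (𝒮 : Screens (Coord p) (Ambient p)) {q : Coord p}
    (hq : q ∈ domain O) (x y : Coord p) {z : Coord p} (hz : tailL p z = 0) :
    curvatureAt (embFH f h) 𝒮 q x y z = 0 := by
  refine curvatureAt_eq_zero (v := (z.1, z.2, 0, 0)) ?_ x y
  filter_upwards [(isOpen_domain hO).mem_nhds hq] with q hq
  rw [fderiv_embFH hO hf hh hq, ← tailL_apply z, hz, map_zero, map_zero]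

/-- `ker (tailL p)` contains the radical, so orthogonality to it makes every `η_i(v)` vanish. What
is left of `g̃(v, ·)` is `g(v, ·)`, and pairing with `∂_{y_i}` reads off the `x_i`-component. -/
theorem tailL_eq_zero_of_associatedMetric (hO : IsOpen O) (hf : ContDiffOn ℝ ∞ f O)
    (hh : ContDiffOn ℝ ∞ h O) {𝒮 : Screens (Coord p) (Ambient p)} {q : Coord p}
    (hq : q ∈ domain O) {r : ℕ} {ξ N : Fin r → Ambient p}
    (hd : IsDualFrame (ambientMetric p) (embFH f h) 𝒮 q ξ N) {v : Coord p}
    (hv : ∀ k, tailL p k = 0 → associatedMetric (ambientMetric p) (embFH f h) q N v k = 0) :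
    tailL p v = 0 := by
  obtain ⟨k, -, hk, hη⟩ := hd.exists_lift isSymm_ambientMetric
  have hN (i : Fin r) : ambientMetric p (N i) (fderiv ℝ (embFH f h) q v) = 0 := by
    rw [← hη]
    apply hv
    have hki := hk i
    rw [inducedMetric_embFH hO hf hh hq, mem_ker_metricFH] at hki
    rw [hki, map_add, map_smul, map_smul, tailL_apply, tailL_apply, tail_xi₁, tail_xi₂]
    simp
  ext i
  have htail : Fin.tail (fieldV i : Coord p).1 = 0 := rfl
  have := hv (fieldV i) htail
  rw [associatedMetric_apply, inducedMetric_embFH hO hf hh hq, metricFH_apply, htail] at this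
  simpa [hN, fieldV, Pi.single_apply, tailL_apply, Fin.tail] using this

theorem pseudoJacobi_embFH (hO : IsOpen O) (hf : ContDiffOn ℝ ∞ f O)
    (hh : ContDiffOn ℝ ∞ h O) {𝒮 : Screens (Coord p) (Ambient p)}
    (h𝒮 : IsAdmissible (ambientMetric p) (embFH f h) (domain O) 2 𝒮) {q : Coord p}
    (hq : q ∈ domain O) (x : Coord p)
    {R : Coord p →ₗ[ℝ] Coord p →ₗ[ℝ] Coord p →ₗ[ℝ] Coord p →ₗ[ℝ] ℝ}
    (hR : IsInducedCurvature (ambientMetric p) (embFH f h) 𝒮 q R) {ξ N : Fin 2 → Ambient p}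
    (hd : IsDualFrame (ambientMetric p) (embFH f h) 𝒮 q ξ N) :
    (∃! J, IsPseudoJacobi (associatedMetric (ambientMetric p) (embFH f h) q N) R x J) ∧
      ∀ J, IsPseudoJacobi (associatedMetric (ambientMetric p) (embFH f h) q N) R x J →
        IsNilpotent J ∧ J.charpoly = Polynomial.X ^ (2 * p + 2) := by
  have hnd := hd.nondegenerate_associatedMetric isSymm_ambientMetric
    ((isSmoothEmbedding_embFH hO hf hh).immersion q hq)
  refine ⟨existsUnique_isPseudoJacobi hnd R x, fun J hJ => ?_⟩
  obtain ⟨S, hS, hSalg⟩ := h𝒮.algebraic q hq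
  -- The algebraic tensor supplied by admissibility is the given `R`, since the induced curvature
  -- determines it.
  obtain rfl := hS.unique hR
  have hnil : IsNilpotent J := by
    refine hJ.isNilpotent hnd hSalg (LinearMap.ker (tailL p).toLinearMap)
      (fun v hv => tailL_eq_zero_of_associatedMetric hO hf hh hq hd hv) fun x y w k hk => ?_
    rw [hS, curvatureAt_embFH_eq_zero hO hf hh 𝒮 hq x y hk, map_zero, LinearMap.zero_apply]
  refine ⟨hnil, ?_⟩
  rw [hnil.charpoly_eq_X_pow_finrank]
  congr 1
  simp
  ring

end LightlikeOsserman

open LightlikeOsserman in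
theorem mainTheorem12 (p : ℕ) (O : Set (Fin p → ℝ)) (hO : IsOpen O)
    (f h : (Fin p → ℝ) → ℝ) (hf : ContDiffOn ℝ ∞ f O) (hh : ContDiffOn ℝ ∞ h O) :
    -- the ambient metric has signature `(p + 2, p + 2)`
    IsSemiEuclidean (ambientMetric p) (p + 2) (p + 2) ∧
    -- `g_(f,h)` is the metric induced by the embedding `F`, and it is 2-degenerate
    IsSmoothEmbedding (domain O) (embFH f h) ∧
    (∀ q ∈ domain O, inducedMetric (ambientMetric p) (embFH f h) q = metricFH f h q) ∧
    (∀ q ∈ domain O, Module.finrank ℝ (LinearMap.ker (metricFH f h q)) = 2) ∧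
    -- the submanifold is coisotropic, with radical distribution spanned by `ξ_1`, `ξ_2`
    IsCoisotropic (ambientMetric p) (embFH f h) (domain O) 2 ∧
    (∀ q ∈ domain O, radSpace (ambientMetric p) (embFH f h) q =
      Submodule.span ℝ {fderiv ℝ (embFH f h) q (xi₁ f q), fderiv ℝ (embFH f h) q (xi₂ h q)}) ∧
    -- the screen distribution spanned by the `U_i`, `V_i` is admissible
    IsAdmissible (ambientMetric p) (embFH f h) (domain O) 2 (screensFH f h) ∧
    -- for all admissible screens, the pseudo-Jacobi operators are well defined, nilpotent, and have
    -- characteristic polynomial `λ ^ (2 p + 2)`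
    (∀ 𝒮 : Screens (Coord p) (Ambient p),
      IsAdmissible (ambientMetric p) (embFH f h) (domain O) 2 𝒮 →
      ∀ q ∈ domain O, ∀ x : Coord p, metricFH f h q x x = 1 ∨ metricFH f h q x x = -1 →
      ∀ R, IsInducedCurvature (ambientMetric p) (embFH f h) 𝒮 q R →
      ∀ ξ N : Fin 2 → Ambient p, IsDualFrame (ambientMetric p) (embFH f h) 𝒮 q ξ N →
        (∃! J, IsPseudoJacobi (associatedMetric (ambientMetric p) (embFH f h) q N) R x J) ∧
        ∀ J, IsPseudoJacobi (associatedMetric (ambientMetric p) (embFH f h) q N) R x J →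
          IsNilpotent J ∧ J.charpoly = Polynomial.X ^ (2 * p + 2)) ∧
    IsGloballyOsserman (ambientMetric p) (embFH f h) (domain O) 2 := by
  have main : ∀ 𝒮 : Screens (Coord p) (Ambient p),
      IsAdmissible (ambientMetric p) (embFH f h) (domain O) 2 𝒮 →
      ∀ q ∈ domain O, ∀ x : Coord p, metricFH f h q x x = 1 ∨ metricFH f h q x x = -1 →
      ∀ R, IsInducedCurvature (ambientMetric p) (embFH f h) 𝒮 q R →
      ∀ ξ N : Fin 2 → Ambient p, IsDualFrame (ambientMetric p) (embFH f h) 𝒮 q ξ N →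
        (∃! J, IsPseudoJacobi (associatedMetric (ambientMetric p) (embFH f h) q N) R x J) ∧
        ∀ J, IsPseudoJacobi (associatedMetric (ambientMetric p) (embFH f h) q N) R x J →
          IsNilpotent J ∧ J.charpoly = Polynomial.X ^ (2 * p + 2) :=
    fun 𝒮 h𝒮 q hq x _ R hR ξ N hd => pseudoJacobi_embFH hO hf hh h𝒮 hq x hR hd
  refine ⟨isSemiEuclidean_ambientMetric p, isSmoothEmbedding_embFH hO hf hh,
    fun q hq => inducedMetric_embFH hO hf hh hq, fun q _ => finrank_ker_metricFH q,
    isCoisotropic_embFH hO hf hh, fun q hq => radSpace_embFH hO hf hh hq,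
    isAdmissible_screensFH hO hf hh, main, ?_⟩
  intro 𝒮 h𝒮 ε hε
  -- One polynomial serves both signs `ε`, all points and all screens.
  refine ⟨Polynomial.X ^ (2 * p + 2), fun q hq x hx R hR ξ N hd => ?_⟩
  rw [inducedMetric_embFH hO hf hh hq] at hx
  obtain ⟨hex, hJ⟩ := main 𝒮 h𝒮 q hq x (by rwa [hx]) R hR ξ N hd
  exact ⟨hex.exists, fun J h => (hJ J h).2⟩
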